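/- Let \textsc{Edge Coloring} be the following problem: given a finite simple undirected graph $G$ and an integer $c\ge 0$, decide whether the edges of $G$ can be colored with at most $c$ colors so that distinct edges sharing an endpoint receive different colors. For an instance $(G,c)$ let $n$ and $m$ be the numbers of vertices and edges of $G$, and let $h_c$ be the number of vertices of $G$ whose degree is exactly $c$. \textsc{Edge Coloring} admits a problem kernel with $\mathcal{O}(h_c\cdot c)$ vertices and $\mathcal{O}(h_c\cdot c^2)$ edges that can be computed in $\mathcal{O}(n+m)$ time, where instances having a vertex of degree greater than $c$ are rejected. Precisely: there are an algorithm and an absolute constant $C$ such that, on every instance $(G,c)$ with $G$ given by a list of its edges, the algorithm computes in $\mathcal{O}(n+m+1)$ steps of a random access machine (with addition, subtraction, comparison and indirect addressing as unit-cost operations, on numbers of size $\mathcal{O}(n+m+c+1)$) an instance $(G',c')$ of \textsc{Edge Coloring} such that 1. $(G,c)$ is a yes-instance if and only if $(G',c')$ is a yes-instance; 2. if every vertex of $G$ has degree at most $c$, then $c'=c$, and $G'$ has at most $C\cdot h_c\cdot c$ vertices and at most $C\cdot h_c\cdot c^2$ edges; 3. if some vertex of $G$ has degree greater than $c$, then the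 instance is rejected, that is, $(G',c')$ is a no-instance with $c'\le c$ and with at most $C$ vertices and at most $C$ edges. -/

import Mathlib

namespace EdgeColoringKernel

/-! ### The problem -/

/-- An instance of Edge Coloring: a finite simple graph, whose vertices are numbered
`0, …, n - 1`, and a number `c` of colors. -/
structure Problem where
  n : ℕ
  graph : SimpleGraph (Fin n)
  c : ℕ

namespace Problem

/-- The question: is there an assignment of at most `c` colors to the edges such that two distinct
edges with a common endpoint always receive distinct colors? -/
def IsYes (I : Problem) : Prop :=
  ∃ f : I.graph.EdgeLabeling (Fin I.c), ∀ e e' : I.graph.edgeSet, e ≠ e' →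
    (∃ v : Fin I.n, v ∈ (e : Sym2 (Fin I.n)) ∧ v ∈ (e' : Sym2 (Fin I.n))) → f e ≠ f e'

/-- The number of edges. -/
noncomputable def m (I : Problem) : ℕ := I.graph.edgeSet.ncard

/-- The degree of a vertex. -/
noncomputable def deg (I : Problem) (v : Fin I.n) : ℕ := (I.graph.neighborSet v).ncard

/-- The number of vertices whose degree is exactly `c`. -/
noncomputable def h (I : Problem) : ℕ := {v : Fin I.n | I.deg v = I.c}.ncard

/-- `L` lists every edge of the graph exactly once (in any order, with the two endpoints in either
order). -/
def IsEdgeList (I : Problem) (L : List (Fin I.n × Fin I.n)) : Prop :=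
  (L.map fun p => s(p.1, p.2)).Nodup ∧
    ∀ e : Sym2 (Fin I.n), e ∈ L.map (fun p => s(p.1, p.2)) ↔ e ∈ I.graph.edgeSet

/-- The sequence of numbers representing an instance: `n`, `m`, `c`, followed by the two endpoints
of every edge in the list. -/
def encode (I : Problem) (L : List (Fin I.n × Fin I.n)) : List ℕ :=
  [I.n, L.length, I.c] ++ L.flatMap fun p => [(p.1 : ℕ), (p.2 : ℕ)]

/-- `w` represents the instance `I` as an edge list. -/
def Encodes (w : List ℕ) (I : Problem) : Prop :=
  ∃ L : List (Fin I.n × Fin I.n), I.IsEdgeList L ∧ w = I.encode L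

end Problem

/-! ### Random access machines

Programs have finitely many registers (those that they mention) and a memory with indirect
addressing; all cells hold natural numbers. The only arithmetic is addition and (truncated)
subtraction. -/

/-- Programs of the random access machine; `a`, `b`, `d` are names of registers. -/
inductive Program : Type
  | const (d k : ℕ) : Program
  | add (d a b : ℕ) : Program
  | sub (d a b : ℕ) : Program
  | load (d a : ℕ) : Program
  | store (a b : ℕ) : Program
  | skip : Program
  | seq (p q : Program) : Program
  | ifLt (a b : ℕ) (p q : Program) : Program
  | whileLt (a b : ℕ) (p : Program) : Program

/-- The contents of the registers and of the memory. -/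
structure State where
  reg : ℕ → ℕ
  mem : ℕ → ℕ

namespace State

/-- Initially the registers are `0`, the input `w` stands in the memory cells from `0` on, and all
further cells are `0`. -/
def initial (w : List ℕ) : State where
  reg := fun _ => 0
  mem := fun i => w.getD i 0

/-- Register `d` receives the value `x`. -/
def setReg (s : State) (d x : ℕ) : State := { s with reg := Function.update s.reg d x }

/-- Memory cell `i` receives the value `x`. -/
def setMem (s : State) (i x : ℕ) : State := { s with mem := Function.update s.mem i x }

/-- The word `w` stands in the memory cells from `0` on. -/
def Holds (s : State) (w : List ℕ) : Prop := ∀ (i : ℕ) (hi : i < w.length), s.mem i = w[i]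

end State

/-- `Exec B p s s' t`: started in the state `s`, the program `p` halts in the state `s'` after
exactly `t` steps, and no number that it writes into a register or a memory cell exceeds `B`.
Each assignment and each evaluation of a condition is one step. -/
inductive Exec (B : ℕ) : Program → State → State → ℕ → Prop
  | const (d k : ℕ) (s : State) (hB : k ≤ B) :
      Exec B (.const d k) s (s.setReg d k) 1
  | add (d a b : ℕ) (s : State) (hB : s.reg a + s.reg b ≤ B) :
      Exec B (.add d a b) s (s.setReg d (s.reg a + s.reg b)) 1
  | sub (d a b : ℕ) (s : State) (hB : s.reg a - s.reg b ≤ B) :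
      Exec B (.sub d a b) s (s.setReg d (s.reg a - s.reg b)) 1
  | load (d a : ℕ) (s : State) (hB : s.mem (s.reg a) ≤ B) :
      Exec B (.load d a) s (s.setReg d (s.mem (s.reg a))) 1
  | store (a b : ℕ) (s : State) (hB : s.reg b ≤ B) :
      Exec B (.store a b) s (s.setMem (s.reg a) (s.reg b)) 1
  | skip (s : State) : Exec B .skip s s 1
  | seq (p q : Program) (s s' s'' : State) (t t' : ℕ) (hp : Exec B p s s' t)
      (hq : Exec B q s' s'' t') : Exec B (.seq p q) s s'' (t + t')
  | ifTrue (a b : ℕ) (p q : Program) (s s' : State) (t : ℕ) (hlt : s.reg a < s.reg b)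
      (hp : Exec B p s s' t) : Exec B (.ifLt a b p q) s s' (t + 1)
  | ifFalse (a b : ℕ) (p q : Program) (s s' : State) (t : ℕ) (hge : ¬ s.reg a < s.reg b)
      (hq : Exec B q s s' t) : Exec B (.ifLt a b p q) s s' (t + 1)
  | whileTrue (a b : ℕ) (p : Program) (s s' s'' : State) (t t' : ℕ) (hlt : s.reg a < s.reg b)
      (hp : Exec B p s s' t) (hrec : Exec B (.whileLt a b p) s' s'' t') :
      Exec B (.whileLt a b p) s s'' (t + t' + 1)
  | whileFalse (a b : ℕ) (p : Program) (s : State) (hge : ¬ s.reg a < s.reg b) :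
      Exec B (.whileLt a b p) s s 1

end EdgeColoringKernel

/-! Call a vertex active if it lies on an edge one of whose endpoints has degree at least `c`. The
kernel is the subgraph induced on the active vertices. An edge that is lost has an inactive endpoint
`v`, so `v` and all its neighbors have degree less than `c`, and in any partial coloring each of
them misses one of the `c` colors. This is all that Vizing's fan argument at `v` requires; degrees
farther away are irrelevant. Hence a coloring of the kernel extends to the lost edges one at a time
(`IsColoring.exists_insert`, `IsColoring.exists_extend`, `isYes_pullback`).

If no degree exceeds `c`, the active vertices lie in the closed neighborhoods of the vertices of
degree exactly `c`, which bounds their number, and the degree sum then bounds the edges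
(`card_pullback_le`, `m_pullback_le`). A vertex of degree greater than `c` rules out a coloring
altogether.

On the machine, three passes over the edge list suffice: counting degrees, numbering the active
vertices, and copying the surviving edges over the input. The arrays indexed by vertices lie in
memory that is zero from the start and are touched only at endpoints of edges, so the time is linear
in the number of edges alone. Each pass is a loop with an invariant and a body of constant cost
(`ends_while`, `ends_of_wp`). -/

namespace EdgeColoringKernel

/-! ### Extending partial edge colorings by Vizing fans -/

section Vizing

variable {V κ : Type*}

/-- `C` colors exactly the edges in `T`, and edges with a common endpoint receive distinct
colors. -/
structure IsColoring (T : Set (Sym2 V)) (C : Sym2 V → Option κ) : Prop where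
  ne_none : ∀ e, C e ≠ none ↔ e ∈ T
  proper : ∀ x y z a, C s(x, y) = some a → C s(x, z) = some a → y = z

/-- No edge at `x` has the color `a`. -/
def Missing (C : Sym2 V → Option κ) (x : V) (a : κ) : Prop := ∀ y, C s(x, y) ≠ some a

variable {T : Set (Sym2 V)} {C : Sym2 V → Option κ}

/-- If every color occurred at `x`, picking a neighbor for each color would be injective and give
too many edges at `x`. -/
theorem IsColoring.exists_missing [Finite V] [Fintype κ] (hC : IsColoring T C) (x : V)
    (h : {y | s(x, y) ∈ T}.ncard < Fintype.card κ) : ∃ a, Missing C x a := by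
  by_contra! hn
  simp only [Missing, not_forall, not_not] at hn
  choose y hy using hn
  have hinj : Function.Injective y := fun a b hab => by
    have h1 := hy a
    rw [hab, hy b] at h1
    exact (Option.some.inj h1).symm
  have hsub : Set.range y ⊆ {y | s(x, y) ∈ T} := by
    rintro _ ⟨a, rfl⟩
    exact (hC.ne_none _).1 (by simp [hy a])
  have := Set.ncard_le_ncard hsub (Set.toFinite _)
  rw [← Set.image_univ, Set.ncard_image_of_injective _ hinj, Set.ncard_univ,
    Nat.card_eq_fintype_card] at this
  omega

open Classical in
theorem IsColoring.uncolor (hC : IsColoring T C) (e : Sym2 V) :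
    IsColoring (T \ {e}) (Function.update C e none) := by
  refine ⟨fun e' => ?_, fun x y z a h1 h2 => ?_⟩
  · by_cases h : e' = e
    · simp [h]
    · simp [h, ← hC.ne_none]
  · rw [Function.update_apply] at h1 h2
    split_ifs at h1 h2
    exact hC.proper x y z a h1 h2

open Classical in
theorem IsColoring.color (hC : IsColoring T C) {v y : V} {a : κ} (hv : Missing C v a)
    (hy : Missing C y a) :
    IsColoring (insert s(v, y) T) (Function.update C s(v, y) (some a)) := by
  have key : ∀ x z w b, s(x, z) = s(v, y) → some a = some b → C s(x, w) ≠ some b := by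
    rintro x z w b h hb
    cases hb
    rcases Sym2.eq_iff.1 h with ⟨rfl, -⟩ | ⟨rfl, -⟩
    · exact hv w
    · exact hy w
  refine ⟨fun e' => ?_, fun x z w b h1 h2 => ?_⟩
  · by_cases h : e' = s(v, y)
    · simp [h]
    · simp [h, ← hC.ne_none]
  · rw [Function.update_apply] at h1 h2
    split_ifs at h1 h2 with c1 c2 c2
    · exact Sym2.congr_right.1 (c1.trans c2.symm)
    · exact (key _ _ _ _ c1 h1 h2).elim
    · exact (key _ _ _ _ c2 h2 h1).elim
    · exact hC.proper x z w b h1 h2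

open Classical in
/-- Shifting a color along a fan completes the coloring. -/
theorem exists_coloring_of_fan {v : V} {α : κ} (l : ℕ) :
    ∀ (C : Sym2 V → Option κ) (y : ℕ → V) (μ : ℕ → κ), IsColoring (T \ {s(v, y 0)}) C →
      s(v, y 0) ∈ T → (∀ i ≤ l, y i ≠ v) → (∀ i ≤ l, ∀ j ≤ l, y i = y j → i = j) →
      (∀ i < l, C s(v, y (i + 1)) = some (μ i)) → (∀ i < l, Missing C (y i) (μ i)) →
      Missing C v α → Missing C (y l) α → ∃ C' : Sym2 V → Option κ, IsColoring T C' := by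
  induction l with
  -- A fan of one edge: `α` is missing at both of its endpoints and colors it.
  | zero =>
    intro C y μ hC hT _ _ _ _ hv hy
    have := hC.color hv hy
    rw [Set.insert_sdiff_singleton, Set.insert_eq_of_mem hT] at this
    exact ⟨_, this⟩
  -- The color `μ 0` moves from the edge to `y 1` to the edge to `y 0`. Now the edge to `y 1` is the
  -- uncolored one, and the fan starting there is shorter.
  | succ l ih =>
    intro C y μ hC hT hne hinj hcol hmis hv hy
    have h10 : y 1 ≠ y 0 := fun h => by simpa using hinj 1 (by omega) 0 (by omega) h
    have hE : s(v, y 0) ≠ s(v, y 1) := fun h => h10 (Sym2.congr_right.1 h).symm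
    have hc0 := hcol 0 (by omega)
    have hm0 := hmis 0 (by omega)
    simp only [zero_add] at hc0
    have hle : ∀ x b, Missing C x b → Missing (Function.update C s(v, y 1) none) x b := by
      intro x b h z hz
      rw [Function.update_apply] at hz
      split_ifs at hz
      exact h z hz
    have hv0 : Missing (Function.update C s(v, y 1) none) v (μ 0) := by
      intro z hz
      rw [Function.update_apply] at hz
      split_ifs at hz with hzy
      exact hzy (by rw [hC.proper _ _ _ _ hz hc0])
    have hC1 := (hC.uncolor s(v, y 1)).color hv0 (hle _ _ hm0)
    set C1 := Function.update (Function.update C s(v, y 1) none) s(v, y 0) (some (μ 0)) with hC1d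
    have hset : insert s(v, y 0) ((T \ {s(v, y 0)}) \ {s(v, y 1)}) = T \ {s(v, y 1)} := by
      ext e
      by_cases he : e = s(v, y 0)
      · simpa [he, hT] using hE
      · simp [he]
    rw [hset] at hC1
    have hmiss : ∀ x b, x ≠ v → x ≠ y 0 → Missing C x b → Missing C1 x b := by
      intro x b hxv hxy h z hz
      rw [hC1d, Function.update_apply] at hz
      split_ifs at hz with hxz
      · rcases Sym2.eq_iff.1 hxz with ⟨h, -⟩ | ⟨h, -⟩
        · exact hxv h
        · exact hxy h
      · exact hle x b h z hz
    have hy0 : ∀ i ≤ l, y (i + 1) ≠ y 0 := fun i hi h => by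
      simpa using hinj (i + 1) (by omega) 0 (by omega) h
    refine ih C1 (fun i => y (i + 1)) (fun i => μ (i + 1)) hC1 ?_ (fun i hi => hne _ (by omega))
      (fun i hi j hj h => by simpa using hinj (i + 1) (by omega) (j + 1) (by omega) h)
      (fun i hi => ?_) (fun i hi => ?_) ?_ ?_
    · exact ((hC.ne_none _).1 (by simp [hc0])).1
    · have e0 : s(v, y (i + 1 + 1)) ≠ s(v, y 0) := fun h => hy0 (i + 1) hi (Sym2.congr_right.1 h)
      have e1 : s(v, y (i + 1 + 1)) ≠ s(v, y 1) := fun h => by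
        simpa using hinj (i + 1 + 1) (by omega) 1 (by omega) (Sym2.congr_right.1 h)
      rw [hC1d, Function.update_of_ne e0, Function.update_of_ne e1]
      exact hcol (i + 1) (by omega)
    · exact hmiss _ _ (hne _ (by omega)) (hy0 i (by omega)) (hmis (i + 1) (by omega))
    -- `v` still misses `α`: the color `μ 0` occurs at `v` under `C`, hence differs from `α`.
    · intro z hz
      rw [hC1d, Function.update_apply] at hz
      split_ifs at hz with hxz
      · exact hv (y 1) (hc0.trans hz)
      · exact hle _ _ hv z hz
    · exact hmiss _ _ (hne _ (by omega)) (hy0 l le_rfl) hy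

open Classical in
/-- Exchanging two colors on a set of vertices that is closed under the edges of these colors. -/
theorem IsColoring.exists_swap (hC : IsColoring T C) (α β : κ) (S : Set V)
    (hS : ∀ x y, (C s(x, y) = some α ∨ C s(x, y) = some β) → x ∈ S → y ∈ S) :
    ∃ C' : Sym2 V → Option κ, IsColoring T C' ∧
      ∀ x y, C' s(x, y) = if x ∈ S then (C s(x, y)).map (Equiv.swap α β) else C s(x, y) := by
  -- The swap must be a function of the unordered pair. An edge with just one endpoint in `S` has
  -- neither color by `hS`, so swapping leaves it alone and the test on `x` agrees with the
  -- symmetric test.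
  have hC' : ∀ x y, (if ∃ z ∈ s(x, y), z ∈ S then (C s(x, y)).map (Equiv.swap α β)
      else C s(x, y)) = if x ∈ S then (C s(x, y)).map (Equiv.swap α β) else C s(x, y) := by
    intro x y
    by_cases hx : x ∈ S
    · simp [hx]
    · by_cases hy : y ∈ S
      · have h1 : C s(x, y) ≠ some α := fun h => hx (hS y x (by rw [Sym2.eq_swap]; simp [h]) hy)
        have h2 : C s(x, y) ≠ some β := fun h => hx (hS y x (by rw [Sym2.eq_swap]; simp [h]) hy)
        rcases hc : C s(x, y) with _ | a
        · simp
        · have ha : a ≠ α := fun h => h1 (by rw [hc, h])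
          have hb : a ≠ β := fun h => h2 (by rw [hc, h])
          simp [Equiv.swap_apply_of_ne_of_ne ha hb]
      · simp [hx, hy]
  refine ⟨fun e => if ∃ z ∈ e, z ∈ S then (C e).map (Equiv.swap α β) else C e, ⟨fun e => ?_,
    fun x y z a h1 h2 => ?_⟩, hC'⟩
  · rw [← hC.ne_none]
    split_ifs <;> simp
  · beta_reduce at h1 h2
    rw [hC'] at h1 h2
    split_ifs at h1 h2
    · rw [Option.map_eq_some_iff] at h1 h2
      obtain ⟨b, hb, hb'⟩ := h1
      obtain ⟨d, hd, hd'⟩ := h2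
      obtain rfl := (Equiv.swap α β).injective (hb'.trans hd'.symm)
      exact hC.proper x y z b hb hd
    · exact hC.proper x y z a h1 h2

open Classical in
/-- A component of a graph of maximum degree two has at most two vertices of degree at most one. -/
theorem not_reachable_of_degree_le_one [Fintype V] (K : SimpleGraph V)
    (h2 : ∀ x, K.degree x ≤ 2) {a b d : V} (hab : a ≠ b) (had : a ≠ d) (hbd : b ≠ d)
    (ha : K.degree a ≤ 1) (hb : K.degree b ≤ 1) (hd : K.degree d ≤ 1)
    (h : K.Reachable a b) : ¬ K.Reachable a d := by
  intro h'
  set S := K.connectedComponentMk a with hS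
  have hcon : (K.induce S.supp).Connected := S.connected_toSimpleGraph
  -- A connected graph on `k` vertices has degree sum at least `2k - 2`, but three vertices of
  -- degree at most one, the others having degree at most two, leave at most `2k - 3`.
  have hcard := hcon.card_vert_le_card_edgeSet_add_one
  have hsum := (K.induce S.supp).sum_degrees_eq_twice_card_edges
  have hdeg : ∀ x : S.supp, (K.induce S.supp).degree x ≤ K.degree x := fun x => by
    rw [← SimpleGraph.card_neighborFinset_eq_degree, ← SimpleGraph.card_neighborFinset_eq_degree,
      ← Finset.card_map (Function.Embedding.subtype _)]
    apply Finset.card_le_card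
    intro y
    simp +contextual
  have hSa : a ∈ S.supp := rfl
  have hSb : b ∈ S.supp := SimpleGraph.ConnectedComponent.eq.2 h.symm
  have hSd : d ∈ S.supp := SimpleGraph.ConnectedComponent.eq.2 h'.symm
  let P : Finset S.supp := {⟨a, hSa⟩, ⟨b, hSb⟩, ⟨d, hSd⟩}
  have hP : P.card = 3 := Finset.card_eq_three.2
    ⟨_, _, _, by simpa using hab, by simpa using had, by simpa using hbd, rfl⟩
  have hle : ∑ x : S.supp, ((K.induce S.supp).degree x + if x ∈ P then 1 else 0)
      ≤ ∑ x : S.supp, 2 := by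
    apply Finset.sum_le_sum
    intro x _
    have h1 := hdeg x
    have h3 := h2 x
    split_ifs with hx
    · simp only [P, Finset.mem_insert, Finset.mem_singleton] at hx
      rcases hx with rfl | rfl | rfl <;> simp only at * <;> omega
    · omega
  rw [Finset.sum_add_distrib, hsum, Finset.sum_ite_mem, Finset.univ_inter, Finset.sum_const, hP,
    Finset.sum_const, Finset.card_univ] at hle
  rw [Nat.card_eq_fintype_card, Nat.card_eq_fintype_card, ← SimpleGraph.edgeFinset_card] at hcard
  simp only [smul_eq_mul] at hle
  omega

/-- The edges that `C` gives one of two colors. -/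
def twoColorGraph (C : Sym2 V → Option κ) (α β : κ) : SimpleGraph V :=
  SimpleGraph.fromEdgeSet {e | C e = some α ∨ C e = some β}

theorem twoColorGraph_adj {α β : κ} {x y : V} : (twoColorGraph C α β).Adj x y ↔
    (C s(x, y) = some α ∨ C s(x, y) = some β) ∧ x ≠ y := by
  simp [twoColorGraph]

-- Each of the two colors occurs at most once at `x`.
open Classical in
theorem IsColoring.degree_twoColorGraph_le [Fintype V] (hC : IsColoring T C) (α β : κ) (x : V) :
    (twoColorGraph C α β).degree x ≤ 2 := by
  rw [← SimpleGraph.card_neighborFinset_eq_degree]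
  have : ((twoColorGraph C α β).neighborFinset x).card ≤ ({some α, some β} : Finset _).card := by
    refine Finset.card_le_card_of_injOn (fun y => C s(x, y)) (fun y hy => ?_) ?_
    · rw [Finset.mem_coe, SimpleGraph.mem_neighborFinset, twoColorGraph_adj] at hy
      simpa using hy.1
    · intro y hy z hz hyz
      rw [Finset.mem_coe, SimpleGraph.mem_neighborFinset, twoColorGraph_adj] at hy hz
      beta_reduce at hyz
      rcases hy.1 with h | h
      · exact hC.proper x y z _ h (hyz ▸ h)
      · exact hC.proper x y z _ h (hyz ▸ h)
  exact this.trans Finset.card_le_two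

-- Thus `v`, which misses `α`, and the fan vertices that miss `β` are all ends of two-colored paths.
open Classical in
theorem IsColoring.degree_twoColorGraph_le_one [Fintype V] (hC : IsColoring T C) {α β : κ} {x : V}
    (hx : Missing C x α ∨ Missing C x β) : (twoColorGraph C α β).degree x ≤ 1 := by
  rw [← SimpleGraph.card_neighborFinset_eq_degree]
  refine Finset.card_le_one.2 fun y hy z hz => ?_
  rw [SimpleGraph.mem_neighborFinset, twoColorGraph_adj] at hy hz
  rcases hx with hx | hx
  · exact hC.proper x y z β (hy.1.resolve_left (hx y)) (hz.1.resolve_left (hx z))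
  · exact hC.proper x y z α (hy.1.resolve_right (hx y)) (hz.1.resolve_right (hx z))

open Classical in
/-- Vizing's extension argument: an uncolored edge at `v` can be colored, if `v` and its neighbors
have fewer incident edges than there are colors. -/
theorem IsColoring.exists_insert [Finite V] [Fintype κ] {v y₀ : V}
    (hC : IsColoring (T \ {s(v, y₀)}) C) (hT : s(v, y₀) ∈ T) (hdiag : ∀ e ∈ T, ¬ e.IsDiag)
    (hv : {y | s(v, y) ∈ T}.ncard < Fintype.card κ)
    (hn : ∀ x, s(v, x) ∈ T → {y | s(x, y) ∈ T}.ncard < Fintype.card κ) :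
    ∃ C' : Sym2 V → Option κ, IsColoring T C' := by
  have := Fintype.ofFinite V
  have hmis : ∀ x, {y | s(x, y) ∈ T}.ncard < Fintype.card κ → ∃ a, Missing C x a := fun x hx =>
    hC.exists_missing x (lt_of_le_of_lt
      (Set.ncard_le_ncard (fun y hy => hy.1) (Set.toFinite _)) hx)
  obtain ⟨α, hα⟩ := hmis v hv
  -- One missing color `μ x` is fixed for each neighbor `x` of `v`; elsewhere the value is
  -- arbitrary.
  have : ∀ x, ∃ a, s(v, x) ∈ T → Missing C x a := fun x => by
    by_cases hx : s(v, x) ∈ T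
    · obtain ⟨a, ha⟩ := hmis x (hn x hx)
      exact ⟨a, fun _ => ha⟩
    · exact ⟨α, fun h => (hx h).elim⟩
  choose μ hμ using this
  have : ∀ x, ∃ z, ¬ Missing C v (μ x) → C s(v, z) = some (μ x) := fun x => by
    by_cases hx : Missing C v (μ x)
    · exact ⟨x, fun h => (h hx).elim⟩
    · simp only [Missing, not_forall, not_not] at hx
      obtain ⟨z, hz⟩ := hx
      exact ⟨z, fun _ => hz⟩
  choose nx hnx using this
  -- The fan: the edge from `v` to `y (t + 1)` has the color chosen as missing at `y t`, as long as
  -- `v` sees that color.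
  let y : ℕ → V := fun t => nx^[t] y₀
  have hys : ∀ t, y (t + 1) = nx (y t) := fun t => Function.iterate_succ_apply' nx t y₀
  -- With finitely many colors the sequence must repeat one, unless it meets a color missing at `v`
  -- before. The fan ends at the first index `j` where either happens.
  have hex : ∃ j, Missing C v (μ (y j)) ∨ ∃ i < j, μ (y i) = μ (y j) := by
    obtain ⟨i, j, hij, h⟩ := Finite.exists_ne_map_eq_of_infinite (fun t => μ (y t))
    rcases lt_or_gt_of_ne hij with h' | h'
    · exact ⟨j, Or.inr ⟨i, h', h⟩⟩
    · exact ⟨i, Or.inr ⟨j, h', h.symm⟩⟩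
  obtain ⟨j, hj, hmin⟩ : ∃ j, (Missing C v (μ (y j)) ∨ ∃ i < j, μ (y i) = μ (y j)) ∧
      ∀ t < j, ¬ (Missing C v (μ (y t)) ∨ ∃ i < t, μ (y i) = μ (y t)) :=
    ⟨Nat.find hex, Nat.find_spec hex, fun t ht => Nat.find_min hex ht⟩
  have hcol : ∀ t < j, C s(v, y (t + 1)) = some (μ (y t)) := fun t ht => by
    rw [hys]
    exact hnx _ fun h => hmin t ht (Or.inl h)
  have hμinj : ∀ i i', i < i' → i' < j → μ (y i) ≠ μ (y i') := fun i i' h h' he =>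
    hmin i' h' (Or.inr ⟨i, h, he⟩)
  have hyT : ∀ t ≤ j, s(v, y t) ∈ T := fun t ht => by
    rcases t with _ | t
    · exact hT
    · exact ((hC.ne_none _).1 (by simp [hcol t ht])).1
  have hyv : ∀ t ≤ j, y t ≠ v := fun t ht h => hdiag _ (hyT t ht) (by simp [h])
  -- If fan vertices coincided, the color `μ` of the predecessor of the later one would sit on the
  -- uncolored edge to `y₀`, or it would repeat before `j`.
  have hlt : ∀ i i', i < i' → i' ≤ j → y i ≠ y i' := by
    intro i i' h h' he
    obtain ⟨i', rfl⟩ := Nat.exists_eq_succ_of_ne_zero (by omega : i' ≠ 0)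
    have h1 := hcol i' h'
    rw [← Nat.succ_eq_add_one, ← he] at h1
    rcases i with _ | i
    · have := (hC.ne_none s(v, y₀)).1
      rw [show y 0 = y₀ from rfl] at h1
      simp [h1] at this
    · rw [hcol i (by omega)] at h1
      exact hμinj i i' (by omega) h' (Option.some.inj h1)
  have hyinj : ∀ i ≤ j, ∀ i' ≤ j, y i = y i' → i = i' := by
    intro i hi i' hi' h
    rcases lt_trichotomy i i' with h' | h' | h'
    · exact (hlt _ _ h' hi' h).elim
    · exact h'
    · exact (hlt _ _ h' hi h.symm).elim
  have hym : ∀ t ≤ j, Missing C (y t) (μ (y t)) := fun t ht => hμ _ (hyT t ht)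
  rcases hj with hj | ⟨i, hij, hμij⟩
  · exact exists_coloring_of_fan j C y (fun t => μ (y t)) hC hT hyv hyinj hcol
      (fun t ht => hym t ht.le) hj (hym j le_rfl)
  obtain ⟨β, hβ⟩ : ∃ β, β = μ (y i) := ⟨_, rfl⟩
  have hαne : ∀ t < j, μ (y t) ≠ α := fun t ht h => hα _ (h ▸ hcol t ht)
  let K := twoColorGraph C α β
  -- Exchanging `α` and `β` on the component of `y l` makes `y l` miss `α`. As `v` is outside, its
  -- edges keep their colors. An earlier `y t` still misses `μ (y t)`: this is never `α`, and it is
  -- not `β` inside the component. So the fan can be shifted up to `l`.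
  have finish : ∀ l ≤ j, μ (y l) = β → ¬ K.Reachable (y l) v →
      (∀ t < l, μ (y t) = β → ¬ K.Reachable (y l) (y t)) →
      ∃ C' : Sym2 V → Option κ, IsColoring T C' := by
    intro l hl hlβ hlv hlt
    obtain ⟨C', hC', hval⟩ := hC.exists_swap α β {x | K.Reachable (y l) x} (by
      intro x z hxz hx
      by_cases h : x = z
      · exact h ▸ hx
      · refine SimpleGraph.Reachable.trans hx (SimpleGraph.Adj.reachable ?_)
        simpa [K, twoColorGraph, h] using hxz)
    have hout : ∀ x, ¬ K.Reachable (y l) x → ∀ z, C' s(x, z) = C s(x, z) := fun x hx z => by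
      rw [hval, if_neg (by simpa using hx)]
    refine exists_coloring_of_fan (α := α) l C' y (fun t => μ (y t)) hC' hT
      (fun t ht => hyv t (by omega)) (fun i hi i' hi' => hyinj i (by omega) i' (by omega))
      (fun t ht => ?_) (fun t ht z hz => ?_) (fun z => ?_) (fun z hz => ?_)
    · rw [hout v hlv, hcol t (by omega)]
    · by_cases hr : K.Reachable (y l) (y t)
      · rw [hval, if_pos (by simpa using hr), Option.map_eq_some_iff] at hz
        obtain ⟨b, hb, hb'⟩ := hz
        have hbt : b = μ (y t) := by
          rw [Equiv.swap_apply_eq_iff, Equiv.swap_apply_of_ne_of_ne (hαne t (by omega))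
            (fun h => hlt t ht h hr)] at hb'
          exact hb'
        exact hym t (by omega) z (hbt ▸ hb)
      · rw [hout _ hr] at hz
        exact hym t (by omega) z hz
    · rw [hout v hlv]
      exact hα z
    · rw [hval, if_pos (by simp), Option.map_eq_some_iff] at hz
      obtain ⟨b, hb, hb'⟩ := hz
      rw [Equiv.swap_apply_eq_iff, Equiv.swap_apply_left] at hb'
      exact hym l hl z (by rw [hlβ, ← hb', hb])
  -- The vertices `v`, `y i` and `y j` cannot all share a component. If `y i` is apart from `v`, the
  -- fan is cut at `i`; otherwise `y j` is apart from both and the whole fan is used.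
  by_cases hiv : K.Reachable (y i) v
  · have hjv : ¬ K.Reachable (y i) (y j) :=
      not_reachable_of_degree_le_one K (fun x => hC.degree_twoColorGraph_le α β x)
        (hyv i hij.le) (hlt i j hij le_rfl) (hyv j le_rfl).symm
        (hC.degree_twoColorGraph_le_one (Or.inr (hβ ▸ hym i hij.le)))
        (hC.degree_twoColorGraph_le_one (Or.inl hα))
        (hC.degree_twoColorGraph_le_one (Or.inr (hβ ▸ hμij ▸ hym j le_rfl))) hiv
    refine finish j le_rfl (by rw [hβ, hμij]) (fun h => hjv (hiv.trans h.symm))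
      (fun t ht htβ h => ?_)
    have : t = i := by
      rcases lt_trichotomy t i with h' | h' | h'
      · exact (hμinj t i h' hij (htβ.trans hβ)).elim
      · exact h'
      · exact (hμinj i t h' ht (htβ.trans hβ).symm).elim
    exact hjv (this ▸ h.symm)
  · exact finish i hij.le hβ.symm hiv fun t ht htβ =>
      (hμinj t i ht hij (htβ.trans hβ)).elim

end Vizing

/-! ### The kernel -/

section Coloring

variable {V W κ : Type*}

open Classical in
/-- A coloring of some of the edges extends to all edges, if every further edge has an endpoint such
that the degrees of it and of its neighbors are smaller than the number of colors. -/
theorem IsColoring.exists_extend [Finite V] [Fintype κ] {G : SimpleGraph V} {T : Set (Sym2 V)}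
    {C : Sym2 V → Option κ} (hC : IsColoring T C) (hT : T ⊆ G.edgeSet)
    (h : ∀ e ∈ G.edgeSet, e ∉ T → ∃ v w, e = s(v, w) ∧
      (G.neighborSet v).ncard < Fintype.card κ ∧
      ∀ x, G.Adj v x → (G.neighborSet x).ncard < Fintype.card κ) :
    ∃ C' : Sym2 V → Option κ, IsColoring G.edgeSet C' := by
  have key : ∃ C' : Sym2 V → Option κ, IsColoring (T ∪ G.edgeSet \ T) C' := by
    refine Set.Finite.induction_on_subset (motive := fun D _ => ∃ C' : Sym2 V → Option κ,
      IsColoring (T ∪ D) C') _ (Set.toFinite (G.edgeSet \ T)) ⟨C, by simpa using hC⟩ ?_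
    rintro e D he hD heD ⟨C', hC'⟩
    obtain ⟨v, w, rfl, hv, hn⟩ := h e he.1 he.2
    have hsub : T ∪ insert s(v, w) D ⊆ G.edgeSet :=
      Set.union_subset hT (Set.insert_subset he.1 (hD.trans Set.sdiff_subset))
    -- The extension step sees only the edges added so far, so degrees in `G` bound the relevant
    -- ones.
    have hle : ∀ x, {y | s(x, y) ∈ T ∪ insert s(v, w) D}.ncard ≤ (G.neighborSet x).ncard :=
      fun x => Set.ncard_le_ncard (fun y hy => hsub hy) (Set.toFinite _)
    have hset : T ∪ D = (T ∪ insert s(v, w) D) \ {s(v, w)} := by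
      ext e
      by_cases h' : e = s(v, w)
      · subst h'
        simp [he.2, heD]
      · simp [h']
    rw [hset] at hC'
    exact hC'.exists_insert (by simp) (fun e he => G.not_isDiag_of_mem_edgeSet (hsub he))
      ((hle v).trans_lt hv) fun x hx => (hle x).trans_lt (hn x (hsub hx))
  rwa [Set.union_sdiff_cancel hT] at key

theorem IsColoring.comap {G : SimpleGraph V} {C : Sym2 V → Option κ} (hC : IsColoring G.edgeSet C)
    {e : W → V} (he : Function.Injective e) :
    IsColoring (G.comap e).edgeSet (C ∘ Sym2.map e) := by
  refine ⟨fun d => ?_, fun x y z a h1 h2 => ?_⟩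
  · induction d with
    | _ x y => simpa using hC.ne_none s(e x, e y)
  · exact he (hC.proper (e x) (e y) (e z) a (by simpa using h1) (by simpa using h2))

theorem IsColoring.map {T : Set (Sym2 W)} {C : Sym2 W → Option κ} (hC : IsColoring T C)
    {e : W → V} (he : Function.Injective e) :
    IsColoring (Sym2.map e '' T) (Function.extend (Sym2.map e) C fun _ => none) := by
  have hinj := Sym2.map.injective he
  have key : ∀ x y a, Function.extend (Sym2.map e) C (fun _ => none) s(x, y) = some a →
      ∃ i j, e i = x ∧ e j = y ∧ C s(i, j) = some a := by
    intro x y a h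
    by_cases hd : ∃ d, Sym2.map e d = s(x, y)
    · obtain ⟨d, hd⟩ := hd
      rw [← hd, hinj.extend_apply] at h
      induction d with
      | _ i j =>
        rw [Sym2.map_mk, Sym2.eq_iff] at hd
        rcases hd with ⟨h1, h2⟩ | ⟨h1, h2⟩
        · exact ⟨i, j, h1, h2, h⟩
        · exact ⟨j, i, h2, h1, by rw [Sym2.eq_swap]; exact h⟩
    · rw [Function.extend_apply' _ _ _ hd] at h
      cases h
  refine ⟨fun d => ?_, fun x y z a h1 h2 => ?_⟩
  · by_cases hd : ∃ d', Sym2.map e d' = d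
    · obtain ⟨d', rfl⟩ := hd
      rw [hinj.extend_apply, hinj.mem_set_image, hC.ne_none]
    · rw [Function.extend_apply' _ _ _ hd]
      simp only [ne_eq, not_true_eq_false, Set.mem_image, false_iff]
      rintro ⟨d', -, h⟩
      exact hd ⟨d', h⟩
  · obtain ⟨i, j, rfl, rfl, h⟩ := key x y a h1
    obtain ⟨i', l, hi, rfl, h'⟩ := key _ z a h2
    obtain rfl := he hi
    rw [hC.proper _ _ _ _ h h']

end Coloring

/-! ### Equivalence with the kernel and its size -/

namespace Problem

open Classical in
-- Colorings with values in `Option` let total and partial colorings be treated alike.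
theorem isYes_iff (I : Problem) :
    I.IsYes ↔ ∃ C : Sym2 (Fin I.n) → Option (Fin I.c), IsColoring I.graph.edgeSet C := by
  constructor
  · rintro ⟨f, hf⟩
    refine ⟨fun e => if h : e ∈ I.graph.edgeSet then some (f ⟨e, h⟩) else none,
      fun e => by simp, fun x y z a h1 h2 => ?_⟩
    split_ifs at h1 h2 with hy hz
    by_contra hyz
    exact hf ⟨_, hy⟩ ⟨_, hz⟩ (fun h => hyz (Sym2.congr_right.1 (Subtype.ext_iff.1 h)))
      ⟨x, by simp, by simp⟩ (Option.some.inj (h1.trans h2.symm))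
  · rintro ⟨C, hC⟩
    have : ∀ e : I.graph.edgeSet, ∃ a, C e = some a := fun e =>
      Option.ne_none_iff_exists'.1 ((hC.ne_none e).2 e.2)
    choose f hf using this
    refine ⟨f, ?_⟩
    rintro e e' hne ⟨v, hv, hv'⟩ hfe
    obtain ⟨y, hy⟩ := hv
    obtain ⟨z, hz⟩ := hv'
    have h1 := hf e
    have h2 := hf e'
    rw [hy] at h1
    rw [hz, ← hfe] at h2
    obtain rfl := hC.proper v y z _ h1 h2
    exact hne (Subtype.ext (hy.trans hz.symm))

theorem not_isYes_of_lt_deg (I : Problem) {v : Fin I.n} (hv : I.c < I.deg v) : ¬ I.IsYes := by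
  rw [isYes_iff]
  rintro ⟨C, hC⟩
  have hle : (I.graph.neighborSet v).ncard ≤ (Set.range (some : Fin I.c → _)).ncard := by
    refine Set.ncard_le_ncard_of_injOn (fun y => C s(v, y)) (fun y hy => ?_) (fun y hy z hz h => ?_)
      (Set.toFinite _)
    · obtain ⟨a, ha⟩ := Option.ne_none_iff_exists'.1 ((hC.ne_none s(v, y)).2 hy)
      exact ⟨a, ha.symm⟩
    · obtain ⟨a, ha⟩ := Option.ne_none_iff_exists'.1 ((hC.ne_none s(v, y)).2 hy)
      exact hC.proper v y z a ha (h.symm.trans ha)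
  rw [← Set.image_univ, Set.ncard_image_of_injective _ (Option.some_injective _), Set.ncard_univ,
    Nat.card_eq_fintype_card, Fintype.card_fin] at hle
  exact absurd hv (not_lt.2 hle)

/-- The vertices of the kernel: the endpoints of edges with an endpoint of degree at least `c`. -/
def IsActive (I : Problem) (u : Fin I.n) : Prop :=
  ∃ w, I.graph.Adj u w ∧ (I.c ≤ I.deg u ∨ I.c ≤ I.deg w)

/-- The subgraph induced on the image of `e`. -/
def pullback (I : Problem) {k : ℕ} (e : Fin k → Fin I.n) : Problem := ⟨k, I.graph.comap e, I.c⟩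

/-- Colorings restrict to the induced subgraph. Conversely, an edge outside it has an inactive
endpoint, where Vizing's extension applies. No bound on the maximum degree is needed. -/
theorem isYes_pullback (I : Problem) {k : ℕ} {e : Fin k → Fin I.n} (he : Function.Injective e)
    (hrange : ∀ u, (∃ i, e i = u) ↔ I.IsActive u) :
    I.IsYes ↔ (I.pullback e).IsYes := by
  rw [isYes_iff, isYes_iff]
  constructor
  · rintro ⟨C, hC⟩
    exact ⟨_, hC.comap he⟩
  · rintro ⟨C, hC⟩
    refine (hC.map he).exists_extend ?_ ?_
    · rintro _ ⟨d, hd, rfl⟩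
      induction d with
      | _ i j => exact hd
    · have key : ∀ v w, I.graph.Adj v w → ¬ I.IsActive v → ∃ v' w', s(v, w) = s(v', w') ∧
          (I.graph.neighborSet v').ncard < Fintype.card (Fin I.c) ∧
          ∀ x, I.graph.Adj v' x → (I.graph.neighborSet x).ncard < Fintype.card (Fin I.c) := by
        intro v w hvw hv
        simp only [IsActive, not_exists, not_and, not_or, not_le] at hv
        rw [Fintype.card_fin]
        exact ⟨v, w, rfl, (hv w hvw).1, fun x hx => (hv x hx).2⟩
      intro d hd hdT
      induction d with
      | _ v w =>
        by_cases hv : I.IsActive v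
        · by_cases hw : I.IsActive w
          · obtain ⟨i, rfl⟩ := (hrange v).2 hv
            obtain ⟨j, rfl⟩ := (hrange w).2 hw
            exact (hdT ⟨s(i, j), hd, rfl⟩).elim
          · rw [Sym2.eq_swap]
            exact key w v (SimpleGraph.Adj.symm hd) hw
        · exact key v w hd hv

theorem card_pullback_le (I : Problem) {k : ℕ} {e : Fin k → Fin I.n} (he : Function.Injective e)
    (hrange : ∀ u, (∃ i, e i = u) ↔ I.IsActive u) (hdeg : ∀ v, I.deg v ≤ I.c) :
    k ≤ 2 * (I.h * I.c) := by
  classical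
  -- Closed neighborhoods of the `h` full vertices give `h * (c + 1)`, which is at most `2 * h * c`
  -- only for positive `c`. For `c = 0` there are no edges, hence no active vertices.
  rcases Nat.eq_zero_or_pos I.c with hc | hc
  · by_contra! hk
    have hk0 : 0 < k := by omega
    obtain ⟨w, hw, -⟩ := (hrange (e ⟨0, hk0⟩)).1 ⟨_, rfl⟩
    have h0 := hdeg (e ⟨0, hk0⟩)
    rw [hc, Nat.le_zero, deg, Set.ncard_eq_zero (Set.toFinite _)] at h0
    exact (h0 ▸ (show w ∈ I.graph.neighborSet _ from hw) : w ∈ (∅ : Set _))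
  · let H := Finset.univ.filter fun v => I.deg v = I.c
    have hH : H.card = I.h := by
      rw [h, ← Set.ncard_coe_finset]
      simp [H]
    have hsub : Finset.univ.image e ⊆ H.biUnion fun u => insert u (I.graph.neighborFinset u) := by
      intro u hu
      obtain ⟨i, -, rfl⟩ := Finset.mem_image.1 hu
      obtain ⟨w, hw, hor⟩ := (hrange _).1 ⟨i, rfl⟩
      rw [Finset.mem_biUnion]
      rcases hor with h | h
      · exact ⟨_, by simpa [H] using le_antisymm (hdeg _) h, by simp⟩
      · exact ⟨w, by simpa [H] using le_antisymm (hdeg _) h, by simp [hw.symm]⟩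
    have hcard := Finset.card_le_card hsub
    rw [Finset.card_image_of_injective _ he, Finset.card_univ, Fintype.card_fin] at hcard
    have h2 := Finset.card_biUnion_le_card_mul H
      (fun u => insert u (I.graph.neighborFinset u)) (I.c + 1) (fun u _ => by
        refine (Finset.card_insert_le _ _).trans ?_
        have := hdeg u
        rw [deg, ← SimpleGraph.coe_neighborFinset, Set.ncard_coe_finset] at this
        omega)
    rw [hH] at h2
    nlinarith

theorem m_pullback_le (I : Problem) {k : ℕ} {e : Fin k → Fin I.n} (he : Function.Injective e)
    (hrange : ∀ u, (∃ i, e i = u) ↔ I.IsActive u) (hdeg : ∀ v, I.deg v ≤ I.c) :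
    (I.pullback e).m ≤ 2 * (I.h * I.c ^ 2) := by
  classical
  have hk := I.card_pullback_le he hrange hdeg
  -- Twice the number of edges is at most `k * c`, and `k` is at most `2 * h * c`.
  have hsum := (I.graph.comap e).sum_degrees_eq_twice_card_edges
  have hle : ∑ i, (I.graph.comap e).degree i ≤ ∑ i : Fin k, I.c := by
    refine Finset.sum_le_sum fun i _ => le_trans ?_ (hdeg (e i))
    rw [← SimpleGraph.card_neighborFinset_eq_degree, ← Set.ncard_coe_finset,
      SimpleGraph.coe_neighborFinset]
    exact Set.ncard_le_ncard_of_injOn e (fun j hj => hj) he.injOn (Set.toFinite _)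
  have hm : (I.pullback e).m = (I.graph.comap e).edgeFinset.card := by
    rw [m, ← Set.ncard_coe_finset, SimpleGraph.coe_edgeFinset]
    rfl
  rw [hsum, ← hm] at hle
  simp only [Finset.sum_const, Finset.card_univ, Fintype.card_fin, smul_eq_mul] at hle
  nlinarith

/-! ### Edge lists -/

section EdgeList

variable {I : Problem} {L : List (Fin I.n × Fin I.n)}

theorem IsEdgeList.m_eq (hL : I.IsEdgeList L) : I.m = L.length := by
  classical
  have : I.graph.edgeSet = ((L.map fun p => s(p.1, p.2)).toFinset : Set _) := by
    ext d
    rw [← hL.2]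
    simp
  rw [m, this, Set.ncard_coe_finset, List.toFinset_card_of_nodup hL.1, List.length_map]

theorem IsEdgeList.adj (hL : I.IsEdgeList L) {p : Fin I.n × Fin I.n} (hp : p ∈ L) :
    I.graph.Adj p.1 p.2 :=
  (hL.2 s(p.1, p.2)).1 (List.mem_map_of_mem (f := fun p : Fin I.n × Fin I.n => s(p.1, p.2)) hp)

theorem IsEdgeList.deg_eq (hL : I.IsEdgeList L) (v : Fin I.n) :
    I.deg v = L.countP fun p => p.1 = v ∨ p.2 = v := by
  classical
  have h1 : I.deg v = (I.graph.incidenceSet v).ncard :=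
    Nat.card_congr (I.graph.incidenceSetEquivNeighborSet v).symm
  have h2 : I.graph.incidenceSet v =
      (((L.map fun p => s(p.1, p.2)).filter fun d => v ∈ d).toFinset : Set _) := by
    ext d
    rw [SimpleGraph.incidenceSet, Set.mem_ofPred_eq, ← hL.2, List.coe_toFinset, Set.mem_ofPred_eq,
      List.mem_filter]
    simp
  rw [h1, h2, Set.ncard_coe_finset, List.toFinset_card_of_nodup (hL.1.filter _),
    ← List.countP_eq_length_filter, List.countP_map]
  congr 1
  ext p
  simp [eq_comm]

/-- In this form activity is settled by one pass over the edges. -/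
theorem IsEdgeList.isActive_iff (hL : I.IsEdgeList L) (u : Fin I.n) :
    I.IsActive u ↔ ∃ p ∈ L, (I.c ≤ I.deg p.1 ∨ I.c ≤ I.deg p.2) ∧ (p.1 = u ∨ p.2 = u) := by
  constructor
  · rintro ⟨w, hw, hd⟩
    obtain ⟨p, hp, hpe⟩ := List.mem_map.1 ((hL.2 s(u, w)).2 hw)
    refine ⟨p, hp, ?_⟩
    rcases Sym2.eq_iff.1 hpe with ⟨rfl, rfl⟩ | ⟨rfl, rfl⟩
    · exact ⟨hd, Or.inl rfl⟩
    · exact ⟨hd.symm, Or.inr rfl⟩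
  · rintro ⟨p, hp, hd, rfl | rfl⟩
    · exact ⟨_, hL.adj hp, hd⟩
    · exact ⟨_, (hL.adj hp).symm, hd.symm⟩

/-- A vertex of degree greater than `c` is not isolated, so it suffices to inspect endpoints of
listed edges. -/
theorem IsEdgeList.exists_lt_deg_iff (hL : I.IsEdgeList L) :
    (∃ v, I.c < I.deg v) ↔ ∃ p ∈ L, I.c < I.deg p.1 ∨ I.c < I.deg p.2 := by
  constructor
  · rintro ⟨v, hv⟩
    have h0 : 0 < I.deg v := by omega
    rw [hL.deg_eq, List.countP_pos_iff] at h0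
    obtain ⟨p, hp, h⟩ := h0
    refine ⟨p, hp, ?_⟩
    rcases of_decide_eq_true h with rfl | rfl
    · exact Or.inl hv
    · exact Or.inr hv
  · rintro ⟨p, -, h | h⟩
    · exact ⟨_, h⟩
    · exact ⟨_, h⟩

/-- `f` numbers the elements on which it does not vanish by `1, …, k`. -/
structure IsNumbering {α : Type*} (f : α → ℕ) (k : ℕ) : Prop where
  le : ∀ u, f u ≤ k
  inj : ∀ u u', f u ≠ 0 → f u = f u' → u = u'
  surj : ∀ i < k, ∃ u, f u = i + 1

/-- Keeps the names, and so the numbers that the machine writes, at most the number of vertices. -/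
theorem IsNumbering.le_card {α : Type*} [Fintype α] {f : α → ℕ} {k : ℕ} (hf : IsNumbering f k) :
    k ≤ Fintype.card α := by
  choose e he using fun i : Fin k => hf.surj i i.2
  have hinj : Function.Injective e := fun i j h => by
    have h1 := he i
    rw [h, he j] at h1
    exact Fin.ext (by omega)
  simpa using Fintype.card_le_of_injective e hinj

theorem IsNumbering.update {α : Type*} [DecidableEq α] {f : α → ℕ} {k : ℕ} (hf : IsNumbering f k)
    {u : α} (hu : f u = 0) : IsNumbering (Function.update f u (k + 1)) (k + 1) := by
  refine ⟨fun x => ?_, fun x y hx hxy => ?_, fun i hi => ?_⟩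
  · have := hf.le x
    rw [Function.update_apply]
    split_ifs <;> omega
  · have h1 := hf.le x
    have h2 := hf.le y
    rw [Function.update_apply] at hx
    rw [Function.update_apply, Function.update_apply] at hxy
    split_ifs at hx hxy with c1 c2 c3
    · rw [c1, c2]
    · omega
    · omega
    · exact hf.inj x y hx hxy
  · rcases Nat.lt_succ_iff_lt_or_eq.1 hi with h | rfl
    · obtain ⟨x, hx⟩ := hf.surj i h
      refine ⟨x, ?_⟩
      rw [Function.update_of_ne, hx]
      rintro rfl
      omega
    · exact ⟨u, by simp⟩

/-- The representation of the kernel. -/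
theorem IsEdgeList.exists_kernel (hL : I.IsEdgeList L) (hdeg : ∀ v, I.deg v ≤ I.c)
    {f : Fin I.n → ℕ} {k : ℕ} (hf : IsNumbering f k) (hact : ∀ u, f u ≠ 0 ↔ I.IsActive u) :
    ∃ J : Problem, J.Encodes ([k, (L.filter fun p => f p.1 ≠ 0 ∧ f p.2 ≠ 0).length, I.c] ++
        (L.filter fun p => f p.1 ≠ 0 ∧ f p.2 ≠ 0).flatMap fun p => [f p.1 - 1, f p.2 - 1]) ∧
      (I.IsYes ↔ J.IsYes) ∧ J.c = I.c ∧ J.n ≤ 2 * (I.h * I.c) ∧ J.m ≤ 2 * (I.h * I.c ^ 2) := by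
  choose e he using fun i : Fin k => hf.surj i i.2
  have hinj : Function.Injective e := fun i j h => by
    have h1 := he i
    rw [h, he j] at h1
    exact Fin.ext (by omega)
  have hrange' : ∀ u, (∃ i, e i = u) ↔ f u ≠ 0 := by
    intro u
    constructor
    · rintro ⟨i, rfl⟩
      simp [he]
    · intro hu
      have := hf.le u
      refine ⟨⟨f u - 1, by omega⟩, (hf.inj u _ hu ?_).symm⟩
      rw [he]
      simp only
      omega
  have hrange : ∀ u, (∃ i, e i = u) ↔ I.IsActive u := fun u => (hrange' u).trans (hact u)
  refine ⟨I.pullback e, ?_, I.isYes_pullback hinj hrange, rfl,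
    I.card_pullback_le hinj hrange hdeg, I.m_pullback_le hinj hrange hdeg⟩
  -- The kept edges join named vertices, so they are the images under `e` of pairs of new names.
  -- Value `0` marks unnamed vertices, and vertex `i` of the kernel has the value `i + 1`.
  obtain ⟨L', hL'⟩ : (L.filter fun p => f p.1 ≠ 0 ∧ f p.2 ≠ 0) ∈
      Set.range (List.map (Prod.map e e)) := by
    rw [Set.range_list_map]
    intro p hp
    have := of_decide_eq_true (List.mem_filter.1 hp).2
    obtain ⟨i, hi⟩ := (hrange' p.1).2 this.1
    obtain ⟨j, hj⟩ := (hrange' p.2).2 this.2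
    exact ⟨(i, j), Prod.ext hi hj⟩
  rw [← hL']
  have hmap : (L'.map fun p => s(p.1, p.2)).map (Sym2.map e) =
      (L.filter fun p => f p.1 ≠ 0 ∧ f p.2 ≠ 0).map fun p => s(p.1, p.2) := by
    rw [← hL', List.map_map, List.map_map]
    rfl
  refine ⟨L', ⟨?_, fun d => ?_⟩, ?_⟩
  · have : ((L'.map fun p => s(p.1, p.2)).map (Sym2.map e)).Nodup := by
      rw [hmap]
      exact hL.1.sublist (List.filter_sublist.map _)
    exact this.of_map _
  · revert d
    change ∀ d : Sym2 (Fin k), d ∈ (L'.map fun p : Fin k × Fin k => s(p.1, p.2)) ↔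
      d ∈ (I.graph.comap e).edgeSet
    intro d
    rw [← List.mem_map_of_injective (Sym2.map.injective hinj), hmap]
    have h1 : Sym2.map e d ∈ I.graph.edgeSet ↔ d ∈ (I.graph.comap e).edgeSet := by
      induction d with
      | _ i j => rfl
    rw [← h1, ← hL.2, List.mem_map, List.mem_map]
    constructor
    · rintro ⟨p, hp, h⟩
      exact ⟨p, (List.mem_filter.1 hp).1, h⟩
    · rintro ⟨p, hp, h⟩
      refine ⟨p, List.mem_filter.2 ⟨hp, decide_eq_true ?_⟩, h⟩
      induction d with
      | _ i j =>
        rw [Sym2.map_mk, Sym2.eq_iff] at h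
        rcases h with ⟨h1, h2⟩ | ⟨h1, h2⟩ <;> simp [h1, h2, he]
  · simp only [encode, List.length_map, List.flatMap_map, Prod.map_fst, Prod.map_snd, he,
      Nat.add_sub_cancel]
    rfl

end EdgeList

/-- The instance with one edge and no color. -/
def rejected : Problem := ⟨2, ⊤, 0⟩

theorem isEdgeList_rejected : rejected.IsEdgeList [((0 : Fin 2), (1 : Fin 2))] := by
  refine ⟨List.nodup_singleton _, ?_⟩
  change ∀ d : Sym2 (Fin 2), d ∈ [s((0 : Fin 2), (1 : Fin 2))] ↔
    d ∈ (⊤ : SimpleGraph (Fin 2)).edgeSet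
  intro d
  induction d with
  | _ x y =>
    rw [List.mem_singleton, SimpleGraph.mem_edgeSet, SimpleGraph.top_adj]
    fin_cases x <;> fin_cases y <;> simp

theorem not_isYes_rejected : ¬ rejected.IsYes := by
  rintro ⟨f, -⟩
  have h : s((0 : Fin 2), (1 : Fin 2)) ∈ (⊤ : SimpleGraph (Fin 2)).edgeSet := by
    rw [SimpleGraph.mem_edgeSet, SimpleGraph.top_adj]
    exact Fin.zero_ne_one
  exact (f ⟨_, h⟩).elim0

end Problem

/-! ### Reasoning about programs -/

namespace Program

/-- The weakest precondition of a program without loops. -/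
def Wp (B : ℕ) : Program → (State → Prop) → State → Prop
  | const d k, Q, s => k ≤ B ∧ Q (s.setReg d k)
  | add d a b, Q, s => s.reg a + s.reg b ≤ B ∧ Q (s.setReg d (s.reg a + s.reg b))
  | sub d a b, Q, s => s.reg a - s.reg b ≤ B ∧ Q (s.setReg d (s.reg a - s.reg b))
  | load d a, Q, s => s.mem (s.reg a) ≤ B ∧ Q (s.setReg d (s.mem (s.reg a)))
  | store a b, Q, s => s.reg b ≤ B ∧ Q (s.setMem (s.reg a) (s.reg b))
  | skip, Q, s => Q s
  | seq p q, Q, s => Wp B p (Wp B q Q) s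
  | ifLt a b p q, Q, s =>
      (s.reg a < s.reg b → Wp B p Q s) ∧ (¬ s.reg a < s.reg b → Wp B q Q s)
  | whileLt _ _ _, _, _ => False

/-- A bound on the number of steps of a program without loops. -/
def cost : Program → ℕ
  | seq p q => p.cost + q.cost
  | ifLt _ _ p q => p.cost + q.cost + 1
  | _ => 1

/-- Started in `s`, the program `p` halts within `T` steps in a state that satisfies `Q`. -/
def Ends (B : ℕ) (p : Program) (T : ℕ) (s : State) (Q : State → Prop) : Prop :=
  ∃ s' t, Exec B p s s' t ∧ t ≤ T ∧ Q s'

variable {B : ℕ}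

/-- The bound `cost` ignores the state, so every loop body without inner loops takes constant time.
-/
theorem ends_of_wp (p : Program) : ∀ {Q : State → Prop} {s : State}, Wp B p Q s →
    Ends B p p.cost s Q := by
  induction p with
  | const d k => exact fun h => ⟨_, _, .const d k _ h.1, le_rfl, h.2⟩
  | add d a b => exact fun h => ⟨_, _, .add d a b _ h.1, le_rfl, h.2⟩
  | sub d a b => exact fun h => ⟨_, _, .sub d a b _ h.1, le_rfl, h.2⟩
  | load d a => exact fun h => ⟨_, _, .load d a _ h.1, le_rfl, h.2⟩
  | store a b => exact fun h => ⟨_, _, .store a b _ h.1, le_rfl, h.2⟩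
  | skip => exact fun h => ⟨_, _, .skip _, le_rfl, h⟩
  | seq p q ihp ihq =>
    intro Q s h
    obtain ⟨s', t, he, ht, h'⟩ := ihp h
    obtain ⟨s'', t', he', ht', h''⟩ := ihq h'
    exact ⟨s'', _, .seq p q _ _ _ _ _ he he', Nat.add_le_add ht ht', h''⟩
  | ifLt a b p q ihp ihq =>
    intro Q s h
    by_cases hlt : s.reg a < s.reg b
    · obtain ⟨s', t, he, ht, h'⟩ := ihp (h.1 hlt)
      exact ⟨s', _, .ifTrue a b p q _ _ _ hlt he, by simp only [cost]; omega, h'⟩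
    · obtain ⟨s', t, he, ht, h'⟩ := ihq (h.2 hlt)
      exact ⟨s', _, .ifFalse a b p q _ _ _ hlt he, by simp only [cost]; omega, h'⟩
  | whileLt a b p => exact fun h => h.elim

theorem Ends.seq {p q : Program} {T T' : ℕ} {s : State} {Q R : State → Prop}
    (hp : Ends B p T s Q) (hq : ∀ s', Q s' → Ends B q T' s' R) :
    Ends B (.seq p q) (T + T') s R := by
  obtain ⟨s', t, he, ht, h'⟩ := hp
  obtain ⟨s'', t', he', ht', h''⟩ := hq s' h'
  exact ⟨s'', _, .seq p q _ _ _ _ _ he he', Nat.add_le_add ht ht', h''⟩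

theorem Ends.ifLt {a b : ℕ} {p q : Program} {T : ℕ} {s : State} {Q : State → Prop}
    (hp : s.reg a < s.reg b → Ends B p T s Q) (hq : ¬ s.reg a < s.reg b → Ends B q T s Q) :
    Ends B (.ifLt a b p q) (T + 1) s Q := by
  by_cases hlt : s.reg a < s.reg b
  · obtain ⟨s', t, he, ht, h'⟩ := hp hlt
    exact ⟨s', _, .ifTrue a b p q _ _ _ hlt he, by omega, h'⟩
  · obtain ⟨s', t, he, ht, h'⟩ := hq hlt
    exact ⟨s', _, .ifFalse a b p q _ _ _ hlt he, by omega, h'⟩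

theorem Ends.mono {p : Program} {T T' : ℕ} {s : State} {Q R : State → Prop}
    (hp : Ends B p T s Q) (hT : T ≤ T') (h : ∀ s', Q s' → R s') : Ends B p T' s R := by
  obtain ⟨s', t, he, ht, h'⟩ := hp
  exact ⟨s', t, he, ht.trans hT, h s' h'⟩

/-- A loop that runs through a list: `Inv l₁ l₂` holds when `l₁` is processed and `l₂` remains. -/
theorem ends_while {α : Type*} {a b : ℕ} {p : Program} {T : ℕ} (Inv : List α → List α → State → Prop)
    (hnil : ∀ l s, Inv l [] s → ¬ s.reg a < s.reg b)
    (hcons : ∀ l x r s, Inv l (x :: r) s →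
      s.reg a < s.reg b ∧ Ends B p T s (Inv (l ++ [x]) r)) (r : List α) :
    ∀ (l : List α) (s : State), Inv l r s →
      Ends B (.whileLt a b p) ((T + 1) * r.length + 1) s (Inv (l ++ r) []) := by
  induction r with
  | nil =>
    intro l s h
    exact ⟨s, 1, .whileFalse a b p s (hnil l s h), by simp, by simpa using h⟩
  | cons x r ih =>
    intro l s h
    obtain ⟨hlt, s', t, he, ht, h'⟩ := hcons l x r s h
    obtain ⟨s'', t', he', ht', h''⟩ := ih _ s' h'
    refine ⟨s'', _, .whileTrue a b p _ _ _ _ _ hlt he he', ?_, by simpa using h''⟩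
    rw [List.length_cons, Nat.mul_succ]
    omega

/-- Executing a list of programs one after the other. -/
def block : List Program → Program
  | [] => skip
  | p :: l => seq p (block l)

end Program

/-! ### Words and arrays in the memory -/

/-- The word `w` stands in the memory cells from `a` on. -/
def WordAt (mem : ℕ → ℕ) (a : ℕ) (w : List ℕ) : Prop :=
  ∀ (i : ℕ) (hi : i < w.length), mem (a + i) = w[i]

/-- The values of `f` stand in the memory cells from `a` on. -/
def ArrayAt {n : ℕ} (mem : ℕ → ℕ) (a : ℕ) (f : Fin n → ℕ) : Prop :=
  ∀ v : Fin n, mem (a + v) = f v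

variable {mem : ℕ → ℕ} {a n : ℕ}

theorem wordAt_nil : WordAt mem a [] := fun i hi => by simp at hi

theorem wordAt_cons {x : ℕ} {w : List ℕ} :
    WordAt mem a (x :: w) ↔ mem a = x ∧ WordAt mem (a + 1) w := by
  constructor
  · refine fun h => ⟨h 0 (by simp), fun i hi => ?_⟩
    have := h (i + 1) (by simpa using hi)
    rwa [show a + (i + 1) = a + 1 + i by omega] at this
  · rintro ⟨h, h'⟩ (_ | i) hi
    · exact h
    · have := h' i (by simpa using hi)
      rwa [Nat.add_assoc, Nat.add_comm 1 i] at this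

theorem wordAt_append {w w' : List ℕ} :
    WordAt mem a (w ++ w') ↔ WordAt mem a w ∧ WordAt mem (a + w.length) w' := by
  induction w generalizing a with
  | nil => simp [wordAt_nil]
  | cons x w ih =>
    rw [List.cons_append, wordAt_cons, wordAt_cons, ih, and_assoc, List.length_cons,
      Nat.add_assoc, Nat.add_comm 1]

theorem WordAt.update {w : List ℕ} (h : WordAt mem a w) {i : ℕ} (x : ℕ)
    (hi : i < a ∨ a + w.length ≤ i) : WordAt (Function.update mem i x) a w := fun j hj => by
  rw [Function.update_of_ne (by omega), h j hj]

theorem ArrayAt.update_of_disjoint {f : Fin n → ℕ} (h : ArrayAt mem a f) {i : ℕ} (x : ℕ)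
    (hi : i < a ∨ a + n ≤ i) : ArrayAt (Function.update mem i x) a f := fun v => by
  rw [Function.update_of_ne (by omega), h v]

theorem ArrayAt.update {f : Fin n → ℕ} (h : ArrayAt mem a f) (v : Fin n) (x : ℕ) :
    ArrayAt (Function.update mem (a + v) x) a (Function.update f v x) := fun u => by
  rw [Function.update_apply, Function.update_apply, h u]
  simp [Fin.ext_iff]

/-- The endpoints of the edges in a list. -/
def endpoints (L : List (Fin n × Fin n)) : List ℕ := L.flatMap fun p => [(p.1 : ℕ), (p.2 : ℕ)]

theorem length_endpoints (L : List (Fin n × Fin n)) : (endpoints L).length = 2 * L.length := by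
  simp [endpoints, Nat.mul_comm]

theorem wordAt_endpoints_cons {p : Fin n × Fin n} {L : List (Fin n × Fin n)} :
    WordAt mem a (endpoints (p :: L)) ↔
      mem a = p.1 ∧ mem (a + 1) = p.2 ∧ WordAt mem (a + 2) (endpoints L) := by
  rw [endpoints, List.flatMap_cons, List.cons_append, List.cons_append, List.nil_append,
    wordAt_cons, wordAt_cons]
  rfl

/-! ### The algorithm -/

open Program

/-- The constants: register `1` holds the number `1`, register `2` the number of colors, registers
`3` and `4` the addresses of the array of degrees and of the array of new names, and register `5`
the address of the first edge. -/
def initProgram : Program := block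
  [.const 1 1, .const 9 2, .load 2 9, .load 10 1, .add 3 10 10, .const 9 3, .add 3 3 9,
    .load 10 0, .add 4 3 10, .const 5 3]

/-- Loading the endpoints of the next edge. -/
def readEdge : List Program := [.load 9 5, .add 5 5 1, .load 10 5, .add 5 5 1]

/-- Counting an edge at both endpoints. -/
def countBody : Program := block <| readEdge ++
  [.add 9 3 9, .load 11 9, .add 11 11 1, .store 9 11,
    .add 10 3 10, .load 11 10, .add 11 11 1, .store 10 11]

/-- Giving a new name to the vertex whose cell has its address in register `r`, unless it has one. -/
def nameVertex (r : ℕ) : Program :=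
  .seq (.load 13 r) (.ifLt 0 13 .skip (.seq (.add 6 6 1) (.store r 6)))

/-- Loading the degrees of the endpoints of the next edge and the addresses of their names. -/
def fetchEdge : Program := block <| readEdge ++
  [.add 11 3 9, .load 11 11, .add 12 3 10, .load 12 12, .add 9 4 9, .add 10 4 10]

/-- Setting the flag in register `8`, if the degree of an endpoint is greater than `c`. -/
def flagEdge : Program :=
  .seq (.ifLt 2 11 (.const 8 1) .skip) (.ifLt 2 12 (.const 8 1) .skip)

/-- Naming both endpoints of an edge. -/
def nameBoth : Program := .seq (nameVertex 9) (nameVertex 10)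

/-- Naming the endpoints of the next edge, if one of their degrees is at least `c`. -/
def nameBody : Program :=
  .seq fetchEdge <| .seq flagEdge <| .ifLt 11 2 (.ifLt 12 2 .skip nameBoth) nameBoth

/-- Copying an edge both of whose endpoints have a new name. -/
def copyBody : Program := block <| readEdge ++
  [.add 9 4 9, .load 9 9, .add 10 4 10, .load 10 10,
    .ifLt 0 9 (.ifLt 0 10 (block [.sub 9 9 1, .store 7 9, .add 7 7 1, .sub 10 10 1, .store 7 10,
      .add 7 7 1, .add 14 14 1]) .skip) .skip]

/-- Writing the instance with one edge and no color. -/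
def rejectProgram : Program := block
  [.const 9 2, .store 0 9, .store 1 1, .store 9 0, .const 9 3, .store 9 0, .const 9 4, .store 9 1]

/-- The kernelization. -/
def kernelProgram : Program :=
  .seq initProgram <| .seq (.whileLt 5 3 countBody) <| .seq (.const 5 3) <|
    .seq (.whileLt 5 3 nameBody) <| .ifLt 0 8 rejectProgram <|
      .seq (block [.const 5 3, .const 7 3, .const 14 0]) <|
        .seq (.whileLt 5 3 copyBody) (block [.store 0 6, .store 1 14])

/-! ### Invariants of the three loop bodies -/

section Correctness

variable {I : Problem} {L : List (Fin I.n × Fin I.n)} {B : ℕ}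

/-- The registers that remain constant, and the part of the input that remains to be read. -/
structure Frame (I : Problem) (L r : List (Fin I.n × Fin I.n)) (s : State) : Prop where
  r0 : s.reg 0 = 0
  r1 : s.reg 1 = 1
  r2 : s.reg 2 = I.c
  r3 : s.reg 3 = 2 * L.length + 3
  r4 : s.reg 4 = 2 * L.length + 3 + I.n
  r5 : s.reg 5 + 2 * r.length = 2 * L.length + 3
  m2 : s.mem 2 = I.c
  input : WordAt s.mem (s.reg 5) (endpoints r)

/-- The invariant of the loop that counts degrees. -/
structure CountInv (I : Problem) (L l r : List (Fin I.n × Fin I.n)) (s : State) : Prop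
    extends Frame I L r s where
  whole : WordAt s.mem 3 (endpoints L)
  degrees : ArrayAt s.mem (2 * L.length + 3) fun v : Fin I.n => l.countP fun p => p.1 = v ∨ p.2 = v
  names : ArrayAt s.mem (2 * L.length + 3 + I.n) fun _ : Fin I.n => 0
  r6 : s.reg 6 = 0
  r8 : s.reg 8 = 0

theorem Frame.setReg {r : List (Fin I.n × Fin I.n)} {s : State} (h : Frame I L r s) {d : ℕ}
    (hd : 6 < d) (x : ℕ) : Frame I L r (s.setReg d x) := by
  have key : ∀ i ≤ 6, (s.setReg d x).reg i = s.reg i := fun i hi =>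
    Function.update_of_ne (by omega) _ _
  exact ⟨by rw [key 0 (by omega), h.r0], by rw [key 1 (by omega), h.r1],
    by rw [key 2 (by omega), h.r2], by rw [key 3 (by omega), h.r3], by rw [key 4 (by omega), h.r4],
    by rw [key 5 (by omega), h.r5], h.m2, by rw [key 5 (by omega)]; exact h.input⟩

theorem countBody_ends (hL : I.IsEdgeList L) (hB : 10 * (I.n + L.length + I.c + 1) ≤ B)
    (l : List (Fin I.n × Fin I.n)) (p : Fin I.n × Fin I.n) (r : List (Fin I.n × Fin I.n))
    (hLe : L = l ++ p :: r) (s : State) (h : CountInv I L l (p :: r) s) :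
    s.reg 5 < s.reg 3 ∧ Ends B countBody 13 s (CountInv I L (l ++ [p]) r) := by
  obtain ⟨⟨h0, h1, h2, h3, h4, h5, hm2, hin⟩, hw, hd, hn, h6, h8⟩ := h
  obtain ⟨hu, hv, hin⟩ := wordAt_endpoints_cons.1 hin
  have hlen : L.length = l.length + r.length + 1 := by simp [hLe]; omega
  rw [List.length_cons] at h5
  have hpu := p.1.2
  have hpv := p.2.2
  -- There are no loops, so the second counter is not the one just increased.
  have hne : ¬ (p.2 : ℕ) = p.1 := fun h =>
    (hL.adj (by simp [hLe] : p ∈ L)).ne (Fin.ext h.symm)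
  have hdu := hd p.1
  have hdv := hd p.2
  have hcu : (l.countP fun q => q.1 = p.1 ∨ q.2 = p.1) ≤ l.length := List.countP_le_length
  have hcv : (l.countP fun q => q.1 = p.2 ∨ q.2 = p.2) ≤ l.length := List.countP_le_length
  refine ⟨by omega, ends_of_wp _ ?_⟩
  simp only [countBody, readEdge, block, List.cons_append, List.nil_append, Wp, State.setReg,
    State.setMem, Function.update_apply, OfNat.one_ne_ofNat, Nat.reduceEqDiff,
    if_true, if_false, h1, h3, hu, hv, hdu, hdv, Nat.add_left_cancel_iff, hne]
  refine ⟨by omega, by omega, by omega, by omega, by omega, by omega, by omega, by omega, by omega,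
    by omega, by omega, by omega, ?_⟩
  exact
    { r0 := h0
      r1 := h1
      r2 := h2
      r3 := h3
      r4 := h4
      r5 := show s.reg 5 + 1 + 1 + 2 * r.length = _ by omega
      m2 := by
        change Function.update (Function.update s.mem _ _) _ _ 2 = _
        rw [Function.update_of_ne (by omega), Function.update_of_ne (by omega), hm2]
      input := by
        have hr := length_endpoints r
        exact (hin.update _ (by omega)).update _ (by omega)
      whole := by
        have hr := length_endpoints L
        exact (hw.update _ (by omega)).update _ (by omega)
      degrees := by
        convert (hd.update p.1 _).update p.2 _ using 1
        ext v
        rw [List.countP_append, Function.update_apply, Function.update_apply]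
        by_cases h2 : v = p.2
        · simp [h2]
        · by_cases h1 : v = p.1
          · simp [h1, show ¬ p.1 = p.2 from fun h => h2 (h1.trans h)]
          · simp [h2, h1, eq_comm]
      names := (hn.update_of_disjoint _ (by omega)).update_of_disjoint _ (by omega)
      r6 := h6
      r8 := h8 }

/-- The part of the invariant of the loop that names vertices that does not concern the edges
already processed; `f` are the names. -/
structure NameInv (I : Problem) (L r : List (Fin I.n × Fin I.n)) (f : Fin I.n → ℕ)
    (s : State) : Prop extends Frame I L r s where
  whole : WordAt s.mem 3 (endpoints L)
  degrees : ArrayAt s.mem (2 * L.length + 3) I.deg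
  names : ArrayAt s.mem (2 * L.length + 3 + I.n) f
  numbering : Problem.IsNumbering f (s.reg 6)

theorem NameInv.setReg {r : List (Fin I.n × Fin I.n)} {f : Fin I.n → ℕ} {s : State}
    (h : NameInv I L r f s) {d : ℕ} (hd : 6 < d) (x : ℕ) : NameInv I L r f (s.setReg d x) :=
  ⟨h.toFrame.setReg hd x, h.whole, h.degrees, h.names, by
    rw [show (s.setReg d x).reg 6 = s.reg 6 from Function.update_of_ne (by omega) _ _]
    exact h.numbering⟩

/-- The address register must survive the writes to registers `13` and `6`. Registers `8` and `10`
are tracked because the flag and the address of the other endpoint are needed later. -/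
theorem nameVertex_ends (hB : 10 * (I.n + L.length + I.c + 1) ≤ B) {r : List (Fin I.n × Fin I.n)}
    {f : Fin I.n → ℕ} {s : State} (h : NameInv I L r f s) {ρ : ℕ} (hρ : ρ ≠ 13 ∧ ρ ≠ 6)
    {u : Fin I.n} (hu : s.reg ρ = 2 * L.length + 3 + I.n + u) :
    Ends B (nameVertex ρ) 5 s fun s' => s'.reg 8 = s.reg 8 ∧ s'.reg 10 = s.reg 10 ∧
      ∃ f', NameInv I L r f' s' ∧ ∀ x, f' x ≠ 0 ↔ f x ≠ 0 ∨ x = u := by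
  have hfu := h.names u
  have hk := h.numbering.le_card
  have hle := h.numbering.le u
  rw [Fintype.card_fin] at hk
  refine ends_of_wp _ ?_
  simp only [nameVertex, Wp, State.setReg,
    State.setMem, Function.update_apply, OfNat.zero_ne_ofNat, Nat.reduceEqDiff, if_true,
    if_false, h.r0, h.r1, hu, hfu, hρ.1, hρ.2]
  refine ⟨by omega, fun hpos => ?_, fun hpos => ?_⟩
  · refine ⟨trivial, trivial, f, h.setReg (by omega) _, fun x => ⟨Or.inl, ?_⟩⟩
    rintro (hx | rfl)
    · exact hx
    · omega
  · have hf0 : f u = 0 := by omega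
    -- The enlarged numbering is again injective on named vertices, so the counter stays at most
    -- `n`.
    have hk' : s.reg 6 + 1 ≤ I.n := by
      simpa using (h.numbering.update hf0).le_card
    refine ⟨by omega, by omega, trivial, trivial, Function.update f u (s.reg 6 + 1), ?_, fun x => ?_⟩
    · have hr := length_endpoints r
      have hL := length_endpoints L
      have h5 := h.r5
      exact
        { r0 := h.r0
          r1 := h.r1
          r2 := h.r2
          r3 := h.r3
          r4 := h.r4
          r5 := h.r5
          m2 := by
            change Function.update s.mem _ _ 2 = _
            rw [Function.update_of_ne (by omega), h.m2]
          input := h.input.update _ (by omega)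
          whole := h.whole.update _ (by omega)
          degrees := h.degrees.update_of_disjoint _ (by omega)
          names := h.names.update u _
          numbering := h.numbering.update hf0 }
    · rw [Function.update_apply]
      by_cases hx : x = u <;> simp [hx]

theorem nameBoth_ends (hB : 10 * (I.n + L.length + I.c + 1) ≤ B) {r : List (Fin I.n × Fin I.n)}
    {f : Fin I.n → ℕ} {s : State} (h : NameInv I L r f s) {u v : Fin I.n}
    (hu : s.reg 9 = 2 * L.length + 3 + I.n + u) (hv : s.reg 10 = 2 * L.length + 3 + I.n + v) :
    Ends B nameBoth 10 s fun s' => s'.reg 8 = s.reg 8 ∧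
      ∃ f', NameInv I L r f' s' ∧ ∀ x, f' x ≠ 0 ↔ f x ≠ 0 ∨ (u = x ∨ v = x) := by
  refine (nameVertex_ends hB h (by decide) hu).seq (T' := 5) ?_
  rintro s' ⟨h8, h10, f', h', hf'⟩
  refine (nameVertex_ends hB h' (by decide) (h10.trans hv)).mono le_rfl ?_
  rintro s'' ⟨h8', -, f'', h'', hf''⟩
  refine ⟨h8'.trans h8, f'', h'', fun x => ?_⟩
  rw [hf'', hf', or_assoc, eq_comm, eq_comm (a := x)]

theorem fetchEdge_ends (hB : 10 * (I.n + L.length + I.c + 1) ≤ B) (hdeg : ∀ v, I.deg v ≤ L.length)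
    {r : List (Fin I.n × Fin I.n)} {p : Fin I.n × Fin I.n} {f : Fin I.n → ℕ} {s : State}
    (h : NameInv I L (p :: r) f s) :
    Ends B fetchEdge 11 s fun s' => NameInv I L r f s' ∧ s'.reg 8 = s.reg 8 ∧
      s'.reg 9 = 2 * L.length + 3 + I.n + p.1 ∧ s'.reg 10 = 2 * L.length + 3 + I.n + p.2 ∧
      s'.reg 11 = I.deg p.1 ∧ s'.reg 12 = I.deg p.2 := by
  obtain ⟨hu, hv, hin⟩ := wordAt_endpoints_cons.1 h.input
  have h5 := h.r5
  rw [List.length_cons] at h5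
  have hpu := p.1.2
  have hpv := p.2.2
  have hdu := hdeg p.1
  have hdv := hdeg p.2
  refine ends_of_wp _ ?_
  simp only [fetchEdge, readEdge, block, List.cons_append, List.nil_append, Wp, State.setReg,
    Function.update_apply, OfNat.one_ne_ofNat,
    Nat.reduceEqDiff, if_true, if_false, h.r1, h.r3, h.r4, hu, hv, h.degrees p.1, h.degrees p.2]
  refine ⟨by omega, by omega, by omega, by omega, by omega, by omega, by omega, by omega, by omega,
    by omega, ?_, by simp⟩
  exact
    { r0 := h.r0
      r1 := h.r1
      r2 := h.r2
      r3 := h.r3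
      r4 := h.r4
      r5 := show s.reg 5 + 1 + 1 + 2 * r.length = _ by omega
      m2 := h.m2
      input := hin
      whole := h.whole
      degrees := h.degrees
      names := h.names
      numbering := h.numbering }

theorem flagEdge_ends (hB : 10 * (I.n + L.length + I.c + 1) ≤ B) {r : List (Fin I.n × Fin I.n)}
    {f : Fin I.n → ℕ} {s : State} (h : NameInv I L r f s) :
    Ends B flagEdge 6 s fun s' => NameInv I L r f s' ∧
      (0 < s'.reg 8 ↔ 0 < s.reg 8 ∨ I.c < s.reg 11 ∨ I.c < s.reg 12) ∧
      s'.reg 9 = s.reg 9 ∧ s'.reg 10 = s.reg 10 ∧ s'.reg 11 = s.reg 11 ∧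
      s'.reg 12 = s.reg 12 := by
  have h8 : ∀ {s : State}, NameInv I L r f s → NameInv I L r f (s.setReg 8 1) := fun h =>
    h.setReg (by omega) 1
  refine ends_of_wp _ ⟨fun h1 => ⟨by omega, fun h2 => ⟨by omega, h8 (h8 h), ?_⟩, fun h2 => ⟨h8 h, ?_⟩⟩,
    fun h1 => ⟨fun h2 => ⟨by omega, h8 h, ?_⟩, fun h2 => ⟨h, ?_⟩⟩⟩
  all_goals
    simp only [State.setReg, Function.update_apply, Nat.reduceEqDiff, if_true, if_false, h.r2] at *
    refine ⟨by omega, by trivial⟩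

/-- The edge has an endpoint of degree at least `c`. -/
def Heavy (I : Problem) (p : Fin I.n × Fin I.n) : Prop := I.c ≤ I.deg p.1 ∨ I.c ≤ I.deg p.2

theorem nameBody_ends (hB : 10 * (I.n + L.length + I.c + 1) ≤ B) (hdeg : ∀ v, I.deg v ≤ L.length)
    {r : List (Fin I.n × Fin I.n)} {p : Fin I.n × Fin I.n} {f : Fin I.n → ℕ} {s : State}
    (h : NameInv I L (p :: r) f s) :
    Ends B nameBody 29 s fun s' =>
      (0 < s'.reg 8 ↔ 0 < s.reg 8 ∨ I.c < I.deg p.1 ∨ I.c < I.deg p.2) ∧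
      ∃ f', NameInv I L r f' s' ∧
        ∀ x, f' x ≠ 0 ↔ f x ≠ 0 ∨ (Heavy I p ∧ (p.1 = x ∨ p.2 = x)) := by
  refine (fetchEdge_ends hB hdeg h).seq (T' := 18) ?_
  rintro s₁ ⟨i₁, h8, h9, h10, h11, h12⟩
  refine (flagEdge_ends hB i₁).seq (T' := 12) ?_
  rintro s₂ ⟨i₂, h8', h9', h10', h11', h12'⟩
  rw [h11, h12, h8] at h8'
  have both : Heavy I p → Ends B nameBoth 10 s₂ fun s' =>
      (0 < s'.reg 8 ↔ 0 < s.reg 8 ∨ I.c < I.deg p.1 ∨ I.c < I.deg p.2) ∧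
      ∃ f', NameInv I L r f' s' ∧
        ∀ x, f' x ≠ 0 ↔ f x ≠ 0 ∨ (Heavy I p ∧ (p.1 = x ∨ p.2 = x)) := fun hp => by
    refine (nameBoth_ends hB i₂ (h9'.trans h9) (h10'.trans h10)).mono le_rfl ?_
    rintro s' ⟨e8, f', hf', hx⟩
    exact ⟨by rw [e8, h8'], f', hf', fun x => by rw [hx]; simp [hp]⟩
  refine Ends.ifLt (T := 11) (fun c1 => Ends.ifLt (T := 10) (fun c2 => ?_) fun c2 => both ?_)
    fun c1 => (both ?_).mono (by omega) fun _ => id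
  · rw [h11', h11, i₂.r2] at c1
    rw [h12', h12, i₂.r2] at c2
    exact ⟨s₂, 1, .skip _, by omega, h8', f, i₂, fun x => by
      simp [Heavy, not_le.2 c1, not_le.2 c2]⟩
  · rw [h12', h12, i₂.r2] at c2
    exact Or.inr (not_lt.1 c2)
  · rw [h11', h11, i₂.r2] at c1
    exact Or.inl (not_lt.1 c1)

/-- The edges both of whose endpoints have a name. -/
def named (f : Fin I.n → ℕ) (l : List (Fin I.n × Fin I.n)) : List (Fin I.n × Fin I.n) :=
  l.filter fun p => f p.1 ≠ 0 ∧ f p.2 ≠ 0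

/-- The endpoints of the edges in a list in terms of the new names. -/
def renamed (f : Fin I.n → ℕ) (l : List (Fin I.n × Fin I.n)) : List ℕ :=
  l.flatMap fun p => [f p.1 - 1, f p.2 - 1]

theorem length_renamed (f : Fin I.n → ℕ) (l : List (Fin I.n × Fin I.n)) :
    (renamed f l).length = 2 * l.length := by
  simp [renamed, Nat.mul_comm]

/-- The invariant of the loop that copies the edges of the kernel. -/
structure CopyInv (I : Problem) (L : List (Fin I.n × Fin I.n)) (f : Fin I.n → ℕ) (k : ℕ)
    (l r : List (Fin I.n × Fin I.n)) (s : State) : Prop extends Frame I L r s where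
  names : ArrayAt s.mem (2 * L.length + 3 + I.n) f
  r6 : s.reg 6 = k
  r7 : s.reg 7 = 3 + 2 * (named f l).length
  r14 : s.reg 14 = (named f l).length
  output : WordAt s.mem 3 (renamed f (named f l))

/-- Copying in place is safe: at most one edge is written per edge read, so the write address in
register `7` stays behind the part of the input still to be read. -/
theorem copyBody_ends (hB : 10 * (I.n + L.length + I.c + 1) ≤ B) {f : Fin I.n → ℕ} {k : ℕ}
    (hf : ∀ v, f v ≤ I.n) (l : List (Fin I.n × Fin I.n)) (p : Fin I.n × Fin I.n)
    (r : List (Fin I.n × Fin I.n)) (hLe : L = l ++ p :: r) (s : State)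
    (h : CopyInv I L f k l (p :: r) s) :
    Ends B copyBody 21 s (CopyInv I L f k (l ++ [p]) r) := by
  obtain ⟨hu, hv, hin⟩ := wordAt_endpoints_cons.1 h.input
  have h5 := h.r5
  have h7 := h.r7
  have h14 := h.r14
  have hlen : L.length = l.length + r.length + 1 := by simp [hLe]; omega
  rw [List.length_cons] at h5
  have hpu := p.1.2
  have hpv := p.2.2
  have hfu := hf p.1
  have hfv := hf p.2
  have hle : (named f l).length ≤ l.length := List.length_filter_le _ _
  have hskip : ¬ (f p.1 ≠ 0 ∧ f p.2 ≠ 0) → named f (l ++ [p]) = named f l := fun hp => by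
    simp only [named, List.filter_append, List.filter_cons, hp, decide_false, List.filter_nil,
      Bool.false_eq_true, if_false, List.append_nil]
  refine ends_of_wp _ ?_
  simp only [copyBody, readEdge, block, List.cons_append, List.nil_append, Wp, State.setReg,
    State.setMem, Function.update_apply, OfNat.one_ne_ofNat,
    OfNat.zero_ne_ofNat, Nat.reduceEqDiff, if_true, if_false, h.r0, h.r1, h.r4, hu, hv,
    h.names p.1, h.names p.2]
  refine ⟨by omega, by omega, by omega, by omega, by omega, by omega, by omega, by omega,
    fun c1 => ⟨fun c2 => ⟨by omega, by omega, by omega, by omega, by omega, by omega, by omega, ?_⟩,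
      fun c2 => ?_⟩, fun c1 => ?_⟩
  · have hn : named f (l ++ [p]) = named f l ++ [p] := by
      have hp : f p.1 ≠ 0 ∧ f p.2 ≠ 0 := ⟨by omega, by omega⟩
      simp only [named, List.filter_append, List.filter_cons, hp, decide_true, List.filter_nil,
        if_true, ne_eq, not_false_eq_true, and_self]
    have hr := length_endpoints r
    have ho := length_renamed f (named f l)
    exact
      { r0 := h.r0
        r1 := h.r1
        r2 := h.r2
        r3 := h.r3
        r4 := h.r4
        r5 := show s.reg 5 + 1 + 1 + 2 * r.length = _ by omega
        m2 := by
          change Function.update (Function.update s.mem _ _) _ _ 2 = _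
          rw [Function.update_of_ne (by omega), Function.update_of_ne (by omega), h.m2]
        input := (hin.update _ (by omega)).update _ (by omega)
        names := (h.names.update_of_disjoint _ (by omega)).update_of_disjoint _ (by omega)
        r6 := h.r6
        r7 := by
          rw [hn, List.length_append, List.length_singleton]
          change s.reg 7 + 1 + 1 = _
          omega
        r14 := by
          rw [hn, List.length_append, List.length_singleton]
          change s.reg 14 + 1 = _
          omega
        output := by
          rw [hn, renamed, List.flatMap_append, wordAt_append]
          refine ⟨(h.output.update _ (by omega)).update _ (by omega), ?_⟩
          change WordAt (Function.update (Function.update s.mem _ _) _ _)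
            (3 + (renamed f (named f l)).length) [f p.1 - 1, f p.2 - 1]
          rw [ho, ← h7, wordAt_cons, wordAt_cons]
          exact ⟨by simp, by simp, wordAt_nil⟩ }
  all_goals
    have hn := hskip (by omega)
    exact
      { r0 := h.r0
        r1 := h.r1
        r2 := h.r2
        r3 := h.r3
        r4 := h.r4
        r5 := show s.reg 5 + 1 + 1 + 2 * r.length = _ by omega
        m2 := h.m2
        input := hin
        names := h.names
        r6 := h.r6
        r7 := by rw [hn]; exact h.r7
        r14 := by rw [hn]; exact h.r14
        output := by rw [hn]; exact h.output }

end Correctness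

/-! ### The complete run of the algorithm -/

open Program

variable {I : Problem} {L : List (Fin I.n × Fin I.n)} {B : ℕ}

theorem wordAt_encode (I : Problem) (L : List (Fin I.n × Fin I.n)) :
    WordAt (State.initial (I.encode L)).mem 0 (I.encode L) := fun i hi => by
  rw [Nat.zero_add]
  exact List.getD_eq_getElem _ _ hi

/-- The arrays of degrees and names lie beyond the input and need no initialization, which would
cost time depending on `n`. -/
theorem initial_mem_of_le (I : Problem) (L : List (Fin I.n × Fin I.n)) {i : ℕ}
    (hi : 2 * L.length + 3 ≤ i) : (State.initial (I.encode L)).mem i = 0 := by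
  have h : (I.encode L).length = 2 * L.length + 3 := by
    have := length_endpoints L
    rw [endpoints] at this
    rw [Problem.encode, List.length_append, this]
    simp [Nat.add_comm]
  exact List.getD_eq_default _ _ (by omega)

theorem initProgram_ends (hB : 10 * (I.n + L.length + I.c + 1) ≤ B) :
    Ends B initProgram 11 (State.initial (I.encode L)) (CountInv I L [] L) := by
  have hw := wordAt_encode I L
  have hz := fun {i : ℕ} => initial_mem_of_le I L (i := i)
  have hreg : ∀ i, (State.initial (I.encode L)).reg i = 0 := fun _ => rfl
  set s := State.initial (I.encode L)
  rw [Problem.encode, List.cons_append, List.cons_append, List.cons_append, List.nil_append,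
    wordAt_cons, wordAt_cons, wordAt_cons] at hw
  obtain ⟨hn, hm, hc, hin⟩ := hw
  simp only [Nat.zero_add, Nat.reduceAdd] at hm hc hin
  refine ends_of_wp _ ?_
  simp only [initProgram, block, Wp, State.setReg, Function.update_apply, OfNat.one_ne_ofNat,
    OfNat.zero_ne_ofNat, OfNat.ofNat_ne_one, zero_ne_one, Nat.reduceEqDiff, if_true, if_false, hreg,
    hn, hm, hc]
  refine ⟨by omega, by omega, by omega, by omega, by omega, by omega, by omega, by omega, by omega,
    by omega, ?_⟩
  exact
    { r0 := rfl
      r1 := rfl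
      r2 := rfl
      r3 := show L.length + L.length + 3 = _ by omega
      r4 := show L.length + L.length + 3 + I.n = _ by omega
      r5 := show 3 + 2 * L.length = _ by omega
      m2 := hc
      input := hin
      whole := hin
      degrees := fun v => hz (by omega)
      names := fun v => hz (by omega)
      r6 := rfl
      r8 := rfl }

theorem countLoop_ends (hL : I.IsEdgeList L) (hB : 10 * (I.n + L.length + I.c + 1) ≤ B) {s : State}
    (h : CountInv I L [] L s) :
    Ends B (.whileLt 5 3 countBody) (14 * L.length + 1) s (CountInv I L L []) := by
  refine (ends_while (T := 13) (fun l r s => L = l ++ r ∧ CountInv I L l r s) ?_ ?_ L [] s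
    ⟨rfl, h⟩).mono le_rfl fun s' h' => h'.2
  · rintro l s ⟨-, h⟩
    have h3 := h.r3
    have h5 := h.r5
    rw [List.length_nil] at h5
    omega
  · rintro l p r s ⟨hLe, h⟩
    obtain ⟨h1, h2⟩ := countBody_ends hL hB l p r hLe s h
    exact ⟨h1, h2.mono le_rfl fun s' h' => ⟨by simp [hLe], h'⟩⟩

theorem nameLoop_ends (hB : 10 * (I.n + L.length + I.c + 1) ≤ B) (hdeg : ∀ v, I.deg v ≤ L.length)
    {s : State} (h : NameInv I L L (fun _ => 0) s) (h8 : s.reg 8 = 0) :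
    Ends B (.whileLt 5 3 nameBody) (30 * L.length + 1) s fun s' =>
      (0 < s'.reg 8 ↔ ∃ p ∈ L, I.c < I.deg p.1 ∨ I.c < I.deg p.2) ∧
      ∃ f, NameInv I L [] f s' ∧ ∀ x, f x ≠ 0 ↔ ∃ p ∈ L, Heavy I p ∧ (p.1 = x ∨ p.2 = x) := by
  refine ends_while (T := 29) (fun l r s =>
    (0 < s.reg 8 ↔ ∃ p ∈ l, I.c < I.deg p.1 ∨ I.c < I.deg p.2) ∧
      ∃ f, NameInv I L r f s ∧ ∀ x, f x ≠ 0 ↔ ∃ p ∈ l, Heavy I p ∧ (p.1 = x ∨ p.2 = x))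
    ?_ ?_ L [] s ⟨by simp [h8], _, h, by simp⟩
  · rintro l s ⟨-, f, h, -⟩
    have h3 := h.r3
    have h5 := h.r5
    rw [List.length_nil] at h5
    omega
  · rintro l p r s ⟨h8, f, h, hf⟩
    refine ⟨?_, (nameBody_ends hB hdeg h).mono le_rfl ?_⟩
    · have h3 := h.r3
      have h5 := h.r5
      rw [List.length_cons] at h5
      omega
    · rintro s' ⟨h8', f', h', hf'⟩
      refine ⟨by rw [h8', h8]; simp [or_and_right, exists_or], f', h', fun x => ?_⟩
      rw [hf', hf]
      simp [or_and_right, exists_or]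

theorem copyLoop_ends (hB : 10 * (I.n + L.length + I.c + 1) ≤ B) {f : Fin I.n → ℕ} {k : ℕ}
    (hf : ∀ v, f v ≤ I.n) {s : State} (h : CopyInv I L f k [] L s) :
    Ends B (.whileLt 5 3 copyBody) (22 * L.length + 1) s (CopyInv I L f k L []) := by
  refine (ends_while (T := 21) (fun l r s => L = l ++ r ∧ CopyInv I L f k l r s) ?_ ?_ L [] s
    ⟨rfl, h⟩).mono le_rfl fun s' h' => h'.2
  · rintro l s ⟨-, h⟩
    have h3 := h.r3
    have h5 := h.r5
    rw [List.length_nil] at h5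
    omega
  · rintro l p r s ⟨hLe, h⟩
    refine ⟨?_, (copyBody_ends hB hf l p r hLe s h).mono le_rfl fun s' h' => ⟨by simp [hLe], h'⟩⟩
    have h3 := h.r3
    have h5 := h.r5
    rw [List.length_cons] at h5
    omega

/-- The five numbers encode `rejected`: two vertices, one edge, no color, and the endpoints `0` and
`1`. -/
theorem rejectProgram_ends (hB : 10 * (I.n + L.length + I.c + 1) ≤ B)
    {r : List (Fin I.n × Fin I.n)} {s : State} (h : Frame I L r s) :
    Ends B rejectProgram 9 s fun s' => s'.Holds [2, 1, 0, 0, 1] := by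
  refine ends_of_wp _ ?_
  simp only [rejectProgram, block, Wp, State.setReg, State.setMem, Function.update_apply,
    OfNat.one_ne_ofNat, OfNat.zero_ne_ofNat, if_true, if_false, h.r0, h.r1]
  refine ⟨by omega, by omega, by omega, by omega, by omega, by omega, by omega, by omega,
    fun i hi => ?_⟩
  simp only [List.length_cons, List.length_nil] at hi
  interval_cases i <;> simp

/-- What the algorithm leaves in the memory. -/
def Result (I : Problem) (L : List (Fin I.n × Fin I.n)) (s : State) : Prop :=
  ((∃ v, I.c < I.deg v) → s.Holds [2, 1, 0, 0, 1]) ∧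
  ((∀ v, I.deg v ≤ I.c) → ∃ f k, Problem.IsNumbering f k ∧ (∀ u, f u ≠ 0 ↔ I.IsActive u) ∧
    s.Holds ([k, (named f L).length, I.c] ++ renamed f (named f L)))

theorem copyPhase_ends (hB : 10 * (I.n + L.length + I.c + 1) ≤ B) {f : Fin I.n → ℕ} {s : State}
    (h : NameInv I L [] f s) :
    Ends B (.seq (block [.const 5 3, .const 7 3, .const 14 0])
      (.seq (.whileLt 5 3 copyBody) (block [.store 0 6, .store 1 14]))) (22 * L.length + 8) s
      fun s' => s'.Holds ([s.reg 6, (named f L).length, I.c] ++ renamed f (named f L)) := by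
  have hk := h.numbering.le_card
  rw [Fintype.card_fin] at hk
  have hlen : (named f L).length ≤ L.length := List.length_filter_le _ _
  have hinit : Ends B (block [.const 5 3, .const 7 3, .const 14 0]) 4 s
      (CopyInv I L f (s.reg 6) [] L) := by
    refine ends_of_wp _ ⟨by omega, by omega, by omega, ?_⟩
    exact
      { r0 := h.r0
        r1 := h.r1
        r2 := h.r2
        r3 := h.r3
        r4 := h.r4
        r5 := show 3 + 2 * L.length = _ by omega
        m2 := h.m2
        input := h.whole
        names := h.names
        r6 := rfl
        r7 := rfl
        r14 := rfl
        output := wordAt_nil }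
  refine (hinit.seq fun s₁ h₁ => (copyLoop_ends hB (fun v => (h.numbering.le v).trans hk) h₁).seq
    (T' := 3) fun s₂ h₂ => ?_).mono (by omega) fun _ => id
  refine ends_of_wp _ ⟨by rw [h₂.r6]; omega, ?_, ?_⟩
  · change s₂.reg 14 ≤ B
    rw [h₂.r14]
    omega
  · intro i hi
    have key : WordAt (Function.update (Function.update s₂.mem (s₂.reg 0) (s₂.reg 6))
        (s₂.reg 1) (s₂.reg 14)) 0
        ([s.reg 6, (named f L).length, I.c] ++ renamed f (named f L)) := by
      rw [h₂.r0, h₂.r1, List.cons_append, List.cons_append, List.cons_append, List.nil_append,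
        wordAt_cons, wordAt_cons, wordAt_cons]
      -- Registers `0` and `1` hold their own indices and serve as addresses of the header cells;
      -- cell `2` has kept `c` from the input.
      exact ⟨h₂.r6, h₂.r14, h₂.m2, (h₂.output.update _ (by omega)).update _ (by omega)⟩
    have := key i hi
    rwa [Nat.zero_add] at this

theorem kernelProgram_ends (hL : I.IsEdgeList L) (hB : 10 * (I.n + L.length + I.c + 1) ≤ B) :
    Ends B kernelProgram (100 * (L.length + 1)) (State.initial (I.encode L)) (Result I L) := by
  have hdeg : ∀ v, I.deg v ≤ L.length := fun v => by
    rw [hL.deg_eq]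
    exact List.countP_le_length
  -- The costs of the consecutive phases; `22 * L.length + 17` covers both rejecting and copying.
  refine Ends.mono (T := 11 + (14 * L.length + 1 + (1 + (30 * L.length + 1 + (22 * L.length + 17 + 1)))))
    ?_ (by omega) fun _ => id
  refine (initProgram_ends hB).seq fun s₁ h₁ => (countLoop_ends hL hB h₁).seq fun s₂ h₂ => ?_
  have h₃ : NameInv I L L (fun _ => 0) (s₂.setReg 5 3) ∧ (s₂.setReg 5 3).reg 8 = 0 :=
    ⟨{ r0 := h₂.r0
       r1 := h₂.r1
       r2 := h₂.r2
       r3 := h₂.r3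
       r4 := h₂.r4
       r5 := show 3 + 2 * L.length = _ by omega
       m2 := h₂.m2
       input := h₂.whole
       whole := h₂.whole
       degrees := fun v => by
         rw [hL.deg_eq]
         exact h₂.degrees v
       names := h₂.names
       numbering := by
         rw [show (s₂.setReg 5 3).reg 6 = 0 from h₂.r6]
         exact ⟨fun _ => le_rfl, fun _ _ h => (h rfl).elim, fun i hi => by omega⟩ }, h₂.r8⟩
  refine (ends_of_wp (Q := (· = s₂.setReg 5 3)) (.const 5 3) ⟨by omega, rfl⟩).seq ?_
  rintro _ rfl
  refine (nameLoop_ends hB hdeg h₃.1 h₃.2).seq ?_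
  rintro s₄ ⟨h8, f, h₄, hf⟩
  rw [← hL.exists_lt_deg_iff] at h8
  have h0 := h₄.r0
  refine Ends.ifLt (fun hlt => ?_) fun hlt => ?_
  · refine (rejectProgram_ends hB h₄.toFrame).mono (by omega) fun s' h' => ⟨fun _ => h', fun h => ?_⟩
    obtain ⟨v, hv⟩ := h8.1 (by omega)
    exact absurd (h v) (not_le.2 hv)
  · refine (copyPhase_ends hB h₄).mono (by omega) fun s' h' =>
      ⟨fun h => absurd (h8.2 h) (by omega), fun _ => ⟨f, _, h₄.numbering, fun u => ?_, h'⟩⟩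
    rw [hf, hL.isActive_iff]
    rfl

end EdgeColoringKernel

theorem mainTheorem6 :
    ∃ (p : EdgeColoringKernel.Program) (C K : ℕ),
      ∀ (I : EdgeColoringKernel.Problem) (w : List ℕ),
        EdgeColoringKernel.Problem.Encodes w I →
        ∃ (J : EdgeColoringKernel.Problem) (w' : List ℕ) (s : EdgeColoringKernel.State) (t : ℕ),
          EdgeColoringKernel.Exec (K * (I.n + I.m + I.c + 1)) p
            (EdgeColoringKernel.State.initial w) s t ∧
          t ≤ K * (I.n + I.m + 1) ∧
          s.Holds w' ∧
          EdgeColoringKernel.Problem.Encodes w' J ∧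
          (I.IsYes ↔ J.IsYes) ∧
          ((∀ v, I.deg v ≤ I.c) →
            J.c = I.c ∧ J.n ≤ C * (I.h * I.c) ∧ J.m ≤ C * (I.h * I.c ^ 2)) ∧
          ((∃ v, I.c < I.deg v) →
            ¬ J.IsYes ∧ J.c ≤ I.c ∧ J.n ≤ C ∧ J.m ≤ C) := by
  open EdgeColoringKernel Problem in
  -- The factor `2` comes from the size bounds and also covers the two vertices of `rejected`; `100`
  -- bounds both the time and the size of numbers, generously.
  refine ⟨kernelProgram, 2, 100, ?_⟩
  rintro I w ⟨L, hL, rfl⟩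
  obtain ⟨s, t, he, ht, hrej, hacc⟩ :=
    kernelProgram_ends (B := 100 * (I.n + I.m + I.c + 1)) hL (by rw [hL.m_eq]; omega)
  have ht' : t ≤ 100 * (I.n + I.m + 1) := by rw [hL.m_eq]; omega
  by_cases hdeg : ∀ v, I.deg v ≤ I.c
  · obtain ⟨f, k, hf, hact, hs⟩ := hacc hdeg
    obtain ⟨J, hJ, hyes, hc, hn, hm⟩ := hL.exists_kernel hdeg hf hact
    exact ⟨J, _, s, t, he, ht', hs, hJ, hyes, fun _ => ⟨hc, hn, hm⟩, fun ⟨v, hv⟩ =>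
      absurd (hdeg v) (not_le.2 hv)⟩
  · obtain ⟨v, hv⟩ : ∃ v, I.c < I.deg v := by simpa using hdeg
    exact ⟨rejected, _, s, t, he, ht', hrej ⟨v, hv⟩, ⟨_, isEdgeList_rejected, rfl⟩,
      iff_of_false (I.not_isYes_of_lt_deg hv) not_isYes_rejected, fun h => absurd h hdeg,
      fun _ => ⟨not_isYes_rejected, Nat.zero_le _, le_rfl, by
        rw [isEdgeList_rejected.m_eq]; simp⟩⟩
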